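/- Let $\mathbb K=\mathbb R$ or $\mathbb C$, let $G$ be a finite-dimensional real Lie group with Lie algebra $\mathfrak g=T_1G$ and let $\rho:G\to GL_N(\mathbb K)$ be either the inclusion of a matrix Lie group (a smooth injective immersive homomorphism; this includes all real matrix Lie groups, as well as $U(N)$ and $SU(N)$), or, for $G=\mathrm{Spin}(N)$, the double covering of $SO(N)$, given in the Clifford algebra of $\mathbb R^N$ (with $v\cdot v=-|v|^2$) by $x\,v\,x^{-1}=\rho(x)(v)$, the Lie group structure on $\mathrm{Spin}(N)$ being the one for which $\rho$ is a smooth immersion. Elements of $\mathfrak g$ are regarded as $N\times N$ matrices through $d\rho_1$. Let $p_1$ be the first Pontryagin polynomial, i.e. the symmetric $\mathrm{Ad}$-invariant $\mathbb R$-bilinear map $\mathfrak g\times\mathfrak g\to\mathbb K$ such that $p_1(A,A)$ is the coefficient of $t^{N-2}$ in $\det\left(t\cdot\mathrm{id}-\frac1{2\pi}A\right)$ (and $0$ if $N<2$). It exists, is unique, and $$p_1(A,B)=\frac1{8\pi^2}\left(\operatorname{tr}A\,\operatorname{tr}B-\operatorname{tr}(AB)\right);$$ if $\rho(G)\subseteq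 U(N)$ its values are real. For $n\ge0$ let $\Delta^n$ be the $n$-simplex with barycentric coordinates $t_0,\dots,t_n$, oriented by $(t_1,\dots,t_n)$, let $EG_n=G^{n+1}$, let $\omega_j$ be the pullback to $EG_n$ of the left Maurer–Cartan form of $G$ along the $j$-th projection, and let $\kappa_n=d\hat\omega_n+\frac12[\hat\omega_n\wedge\hat\omega_n]$ be the curvature of the connection $\hat\omega_n=\sum_{j=0}^n t_j\,\omega_j$ on $\Delta^n\times EG_n$. Wedge products of an $a$-form and a $b$-form carry the coefficient $\frac1{a!\,b!}$, and multilinear maps and matrix products are applied to wedge products of Lie algebra valued forms. Shulman's construction assigns to $p_1$ the $(4-n)$-forms $$\chi_n=\int_{\Delta^n}p_1(\kappa_n,\kappa_n)$$ on $EG_n$, where the integral along the fibre $\Delta^n$ uses the first $n$ arguments for the fibre directions, and is $0$ by convention for $n>4$. Then, with $\bar\omega_i=\omega_i-\omega_0$, $$\chi_1=\frac1{24\pi^2}\operatorname{tr}(\bar\omega_1\cdot\bar\omega_1\cdot\bar\omega_1),\qquad \chi_2=\frac1{8\pi^2}\left(\operatorname{tr}(\bar\omega_1\cdot\bar\omega_2)-\operatorname{tr}(\bar\omega_1)\cdot\operatorname{tr}(\bar\omega_2)\right),\qquad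 \chi_n=0\ \text{ for } n\ne1,2.$$ -/

import Mathlib

open scoped Manifold ContDiff

namespace Shulman

/-! ### Exterior derivative and wedge products -/

/-- Exterior derivative of a vector-valued differential `k`-form on a manifold. Its value at `x` is
computed in the preferred chart at `x`: the form is pulled back to the model space by the inverse of
the chart, differentiated there, and the result is pulled back to `T_x M` by the chart. The
normalisation is `dθ(v, w) = v(θ(w)) - w(θ(v)) - θ([v, w])` for `1`-forms. -/
noncomputable def mextDeriv {B : Type*} [NormedAddCommGroup B] [NormedSpace ℝ B]
    {H : Type*} [TopologicalSpace H] (I : ModelWithCorners ℝ B H)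
    {M : Type*} [TopologicalSpace M] [ChartedSpace H M]
    {F : Type*} [NormedAddCommGroup F] [NormedSpace ℝ F] {k : ℕ}
    (θ : ∀ x : M, TangentSpace I x [⋀^Fin k]→L[ℝ] F) (x : M) :
    TangentSpace I x [⋀^Fin (k + 1)]→L[ℝ] F :=
  (extDerivWithin
    (fun y : B => (θ ((extChartAt I x).symm y)).compContinuousLinearMap
      (mfderivWithin 𝓘(ℝ, B) I (extChartAt I x).symm (Set.range I) y))
    (Set.range I) (extChartAt I x x)).compContinuousLinearMap
      (mfderiv I 𝓘(ℝ, B) (extChartAt I x) x)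

/-- `[φ ∧ ψ]` for two `1`-forms (at a point) with values in a Lie algebra. -/
def bracketWedge {T L : Type*} [AddCommGroup L] [Bracket L L] (φ ψ : T → L) (v : Fin 2 → T) : L :=
  ∑ σ : Equiv.Perm (Fin 2), Equiv.Perm.sign σ • ⁅φ (v (σ 0)), ψ (v (σ 1))⁆

/-- `f(φ₁, …, φ_k) = f ∘ (φ₁ ∧ ⋯ ∧ φ_k)` for a `k`-multilinear `f : V^k → W` and `V`-valued
`d`-forms `φᵢ` (at a point), where wedge products carry the coefficient `1 / (a! b!)` for forms of
degrees `a` and `b`. The `i`-th form receives the `i`-th block of `d` consecutive permuted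
arguments. -/
noncomputable def polyWedge (d k : ℕ) {T V W : Type*} [AddCommGroup W] [Module ℝ W]
    (f : (Fin k → V) → W) (φ : Fin k → (Fin d → T) → V) (w : Fin (k * d) → T) : W :=
  (1 / ((Nat.factorial d : ℝ) ^ k)) • ∑ σ : Equiv.Perm (Fin (k * d)),
    Equiv.Perm.sign σ • f (fun i => φ i (fun j => w (σ (finProdFinEquiv (i, j)))))

section LieGroups

variable (E : Type*) [NormedAddCommGroup E] [NormedSpace ℝ E]
  {G : Type*} [TopologicalSpace G] [ChartedSpace E G] [Group G]

/-! ### The Maurer-Cartan form and invariant polynomials -/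

/-- The (left) Maurer-Cartan form `ω_g : T_g G → T_1 G = 𝔤`, the derivative at `g` of left
translation by `g⁻¹`. -/
noncomputable def maurerCartan (g : G) :
    TangentSpace 𝓘(ℝ, E) g →L[ℝ] GroupLieAlgebra 𝓘(ℝ, E) G :=
  mfderiv 𝓘(ℝ, E) 𝓘(ℝ, E) (fun x : G => g⁻¹ * x) g

/-- The adjoint representation `Ad_g : 𝔤 → 𝔤`. -/
noncomputable def adjoint (g : G) :
    GroupLieAlgebra 𝓘(ℝ, E) G →L[ℝ] GroupLieAlgebra 𝓘(ℝ, E) G :=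
  mfderiv 𝓘(ℝ, E) 𝓘(ℝ, E) (fun x : G => g * x * g⁻¹) 1

/-- `f` belongs to `I^k(𝔤)`: the `k`-multilinear map `f` is symmetric and `Ad`-invariant. -/
def IsInvariantPolynomial {W : Type*} [AddCommGroup W] [Module ℝ W] {k : ℕ}
    (f : MultilinearMap ℝ (fun _ : Fin k => GroupLieAlgebra 𝓘(ℝ, E) G) W) : Prop :=
  (∀ (σ : Equiv.Perm (Fin k)) (v : Fin k → GroupLieAlgebra 𝓘(ℝ, E) G),
    f (fun i => v (σ i)) = f v) ∧
  ∀ (g : G) (v : Fin k → GroupLieAlgebra 𝓘(ℝ, E) G), f (fun i => adjoint E g (v i)) = f v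

/-! ### Shulman's construction

`EG_n = G^(n+1)` is `Fin (n + 1) → G`. The `n`-simplex is parametrised by its last `n` barycentric
coordinates `(t₁, …, t_n)`, which also give its orientation; `t₀ = 1 - ∑ tᵢ`. The canonical
connection is given by a formula which makes sense for all `t ∈ ℝⁿ`, so that `Δⁿ × EG_n` is regarded
as a subset of the boundaryless manifold `ℝⁿ × EG_n`. -/

/-- The model with corners of the manifold `ℝⁿ × G^(n+1)`. -/
noncomputable abbrev totalModel (n : ℕ) : ModelWithCorners ℝ ((Fin n → ℝ) × (Fin (n + 1) → E))
    (ModelProd (Fin n → ℝ) (ModelPi fun _ : Fin (n + 1) => E)) :=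
  𝓘(ℝ, Fin n → ℝ).prod (ModelWithCorners.pi fun _ : Fin (n + 1) => 𝓘(ℝ, E))

/-- The `n`-simplex in the coordinates `(t₁, …, t_n)`. -/
noncomputable def simplex (n : ℕ) : Set (Fin n → ℝ) := {t | (∀ i, 0 ≤ t i) ∧ ∑ i, t i ≤ 1}

/-- The barycentric coordinates `(t₀, t₁, …, t_n)`. -/
noncomputable def barycentric {n : ℕ} (t : Fin n → ℝ) : Fin (n + 1) → ℝ := Fin.cons (1 - ∑ i, t i) t

/-- The canonical connection `∑ⱼ tⱼ ωⱼ` on `Δⁿ × EG_n`, where `ωⱼ` is the pullback of the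
Maurer-Cartan form along the `j`-th projection `EG_n → G`. The Lie algebra `𝔤 = T_1 G` is written as
its underlying normed space `E`. -/
noncomputable def canonicalConnection (n : ℕ) (p : (Fin n → ℝ) × (Fin (n + 1) → G)) :
    TangentSpace (totalModel E n) p →L[ℝ] E :=
  ∑ j : Fin (n + 1), barycentric p.1 j •
    ((maurerCartan E (p.2 j) : E →L[ℝ] E).comp
      ((ContinuousLinearMap.proj j).comp
        (ContinuousLinearMap.snd ℝ (Fin n → ℝ) (Fin (n + 1) → E))))

/-- The curvature `κ_n = dθ + ½ [θ ∧ θ]` of the canonical connection `θ` on `Δⁿ × EG_n`. -/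
noncomputable def curvature (n : ℕ) (p : (Fin n → ℝ) × (Fin (n + 1) → G))
    (v : Fin 2 → TangentSpace (totalModel E n) p) : GroupLieAlgebra 𝓘(ℝ, E) G :=
  let dθ : GroupLieAlgebra 𝓘(ℝ, E) G :=
    mextDeriv (totalModel E n)
      (fun q : (Fin n → ℝ) × (Fin (n + 1) → G) =>
        ContinuousAlternatingMap.ofSubsingleton ℝ (TangentSpace (totalModel E n) q) E (0 : Fin 1)
          (canonicalConnection E n q)) p v
  let θ : TangentSpace (totalModel E n) p → GroupLieAlgebra 𝓘(ℝ, E) G :=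
    fun w => canonicalConnection E n p w
  dθ + (1 / 2 : ℝ) • bracketWedge θ θ v

/-- Shulman's forms: for `f ∈ I^k(𝔤)`, the `(2k - n)`-form `χ_n(f) = ∫_{Δⁿ} f(κ_n, …, κ_n)` on
`EG_n`, evaluated at the point `g` on the tangent vectors `u`. The integral along the fibre feeds
`∂/∂t₁, …, ∂/∂t_n` into the first `n` slots and lifts of `u` into the others; it is `0` by
convention if the degree `2k` is smaller than the dimension `n` of the fibre. -/
noncomputable def shulmanForm {W : Type*} [NormedAddCommGroup W] [NormedSpace ℝ W] {k : ℕ}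
    (f : MultilinearMap ℝ (fun _ : Fin k => GroupLieAlgebra 𝓘(ℝ, E) G) W) (n : ℕ)
    (g : Fin (n + 1) → G) (u : Fin (k * 2 - n) → ∀ j, TangentSpace 𝓘(ℝ, E) (g j)) : W :=
  if n ≤ k * 2 then
    ∫ t in simplex n, polyWedge 2 k f (fun _ => curvature E n (t, g))
      (fun i : Fin (k * 2) =>
        if hi : (i : ℕ) < n then
          ((Pi.single (⟨i, hi⟩ : Fin n) (1 : ℝ) : Fin n → ℝ), (0 : Fin (n + 1) → E))
        else ((0 : Fin n → ℝ), u ⟨(i : ℕ) - n, by have := i.2; omega⟩))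
  else 0

/-- The `𝔤`-valued `1`-form `ω̄ᵢ = ωᵢ - ω₀` on `EG_n`, at the point `g`. -/
noncomputable def omegaBar {n : ℕ} (i : Fin (n + 1)) (g : Fin (n + 1) → G)
    (u : ∀ j, TangentSpace 𝓘(ℝ, E) (g j)) : GroupLieAlgebra 𝓘(ℝ, E) G :=
  maurerCartan E (g i) (u i) - maurerCartan E (g 0) (u 0)

/-! ### Matrix Lie groups and Pontryagin polynomials -/

variable {𝕜 : Type*} [RCLike 𝕜] {N : ℕ}

/-- The homomorphism `ρ` is smooth (its matrix entries are smooth) and an immersion. -/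
def IsSmoothImmersion (ρ : G →* GL (Fin N) 𝕜) : Prop :=
  (∀ i j, ContMDiff 𝓘(ℝ, E) 𝓘(ℝ, 𝕜) ∞ (fun g : G => (ρ g : Matrix (Fin N) (Fin N) 𝕜) i j)) ∧
  ∀ (g : G) (v : TangentSpace 𝓘(ℝ, E) g),
    (∀ i j, mfderiv 𝓘(ℝ, E) 𝓘(ℝ, 𝕜) (fun h : G => (ρ h : Matrix (Fin N) (Fin N) 𝕜) i j) g v
      = 0) → v = 0

/-- `G` is a matrix Lie group, i.e. a Lie subgroup of `GL(N, 𝕜)`, with inclusion `ρ`. -/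
def IsMatrixLieGroup (ρ : G →* GL (Fin N) 𝕜) : Prop :=
  IsSmoothImmersion E ρ ∧ Function.Injective ρ

/-- The quadratic form `v ↦ -|v|²` on `ℝ^N`. Its Clifford algebra has `v · v = -|v|²`. -/
noncomputable def negSq (N : ℕ) : QuadraticForm ℝ (Fin N → ℝ) :=
  QuadraticMap.weightedSumSquares ℝ (fun _ : Fin N => (-1 : ℝ))

/-- `G` is the Lie group `Spin(N)`, and `ρ` is its covering map onto `SO(N) ⊆ GL(N)`, given by
`x · v · x⁻¹ = ρ(x)(v)` in the Clifford algebra; the manifold structure is the one for which the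
covering map is a smooth immersion. -/
def IsSpinCovering (ρ : G →* GL (Fin N) 𝕜) : Prop :=
  IsSmoothImmersion E ρ ∧
  ∃ e : G ≃* spinGroup (negSq N), ∀ g : G, ∃ R : Matrix (Fin N) (Fin N) ℝ,
    (ρ g : Matrix (Fin N) (Fin N) 𝕜) = R.map (fun x : ℝ => (x : 𝕜)) ∧
    ∀ v : Fin N → ℝ,
      (e g : CliffordAlgebra (negSq N)) * CliffordAlgebra.ι (negSq N) v *
        ((e g)⁻¹ : spinGroup (negSq N)) = CliffordAlgebra.ι (negSq N) (R.mulVec v)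

/-- The matrix representing an element of the Lie algebra, i.e. the derivative of `ρ` at `1`. -/
noncomputable def toMatrix (ρ : G →* GL (Fin N) 𝕜) (A : GroupLieAlgebra 𝓘(ℝ, E) G) :
    Matrix (Fin N) (Fin N) 𝕜 :=
  Matrix.of fun i j =>
    mfderiv 𝓘(ℝ, E) 𝓘(ℝ, 𝕜) (fun g : G => (ρ g : Matrix (Fin N) (Fin N) 𝕜) i j) 1 A

/-- `p` is the Pontryagin polynomial `p_{k/2}` of degree `k`: a `k`-linear form in `I^k(𝔤)` with
`det (t - A / 2π) = ∑ₖ p_{k/2}(A, …, A) t^(N-k)`. -/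
def IsPontryaginPolynomial (ρ : G →* GL (Fin N) 𝕜) {k : ℕ}
    (p : MultilinearMap ℝ (fun _ : Fin k => GroupLieAlgebra 𝓘(ℝ, E) G) 𝕜) : Prop :=
  IsInvariantPolynomial E p ∧
  ∀ A : GroupLieAlgebra 𝓘(ℝ, E) G, p (fun _ => A) =
    if k ≤ N then
      (Matrix.charpoly (((1 / (2 * Real.pi) : ℝ) : 𝕜) • toMatrix E ρ A)).coeff (N - k)
    else 0

end LieGroups

end Shulman

/-! Both kinds of group enter through one fact: `ρ`, viewed as a homomorphism `R` into the normed
algebra `A` of matrices, is smooth with injective derivative `D` at `1`. So `D` has a linear left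
inverse, and all computations can be carried out in `A`, where `D ∘ ωⱼ` is the classical form `aⱼ =
Rⱼ⁻¹ dRⱼ` and the Lie bracket becomes the commutator (`derivOne_bracket`). The connection then reads
`∑ (tⱼ Rⱼ⁻¹) dRⱼ`. Its exterior derivative follows from `d(h dF) = dh ∧ dF`, and
`derivOne_curvature` gives the image of the curvature as `∑ (dtⱼ ∧ aⱼ - tⱼ aⱼ ∧ aⱼ) + (∑ tⱼ aⱼ) ∧ (∑
tⱼ aⱼ)`.

On `n` fibre vectors and `4 - n` vectors of `EG_n`, the form `p₁(κ, κ)` is twice the signed sum over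
the three ways to split four arguments into two pairs (`polyWedge_curvature`). The curvature
vanishes on two fibre vectors, and `κ(∂/∂tᵢ, u) = ω̄ᵢ(u)`. Hence `n ≥ 3` gives `0`, because each
splitting pairs two of the first three arguments. For `n = 0` the connection is the flat form `ω₀`.
For `n = 2` the integrand is constant and the triangle has area `1/2`. For `n = 1` the curvature on
two vectors of `EG_1` is `t² - t` times the commutator of the values of `ω̄₁`, and `∫ (t² - t) =
-1/6` leads to the factor `1/3`.

The polynomial itself comes from writing the coefficient of `t^(N-2)` as the sum of the principal `2
× 2` minors, which is half of `(tr M)² - tr M²` (`two_mul_charpoly_coeff`); uniqueness is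
polarisation (`multilinearMap_eq_of_diagonal`). -/

namespace Shulman

/-! ### Products of manifolds modelled on normed spaces -/

section PiManifold

variable {ι : Type*} [Fintype ι] {E : Type*} [NormedAddCommGroup E] [NormedSpace ℝ E]
  {G : Type*} [TopologicalSpace G] [ChartedSpace E G]

instance boundaryless_pi_self :
    (ModelWithCorners.pi fun _ : ι => 𝓘(ℝ, E)).Boundaryless := by
  constructor
  rw [Set.eq_univ_iff_forall]
  intro y
  exact ⟨y, rfl⟩

instance isManifold_pi_self {n : ℕ∞ω} [IsManifold 𝓘(ℝ, E) n G] :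
    IsManifold (ModelWithCorners.pi fun _ : ι => 𝓘(ℝ, E)) n (ι → G) := by
  apply isManifold_of_contDiffOn
  rintro _ _ ⟨e, he, rfl⟩ ⟨e', he', rfl⟩
  rw [contDiffOn_pi]
  intro i
  have h := ((contDiffGroupoid n 𝓘(ℝ, E)).compatible (he i trivial) (he' i trivial))
  rw [contDiffGroupoid, mem_groupoid_of_pregroupoid] at h
  have h1 := h.1
  simp only [contDiffPregroupoid] at h1
  refine (h1.comp (t := _) (f := fun y : ι → E => y i)
    (contDiff_apply ℝ E i).contDiffOn ?_)
  rintro y ⟨hy, -⟩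
  refine ⟨?_, by simp⟩
  exact ⟨hy.1 i trivial, hy.2 i trivial⟩

/-- In the product chart at `g` and the chart at `g j`, the projection agrees near the base point
with the linear coordinate map. -/
lemma hasMFDerivAt_apply (g : ι → G) (j : ι) :
    HasMFDerivAt (ModelWithCorners.pi fun _ : ι => 𝓘(ℝ, E)) 𝓘(ℝ, E) (fun h : ι → G => h j) g
      (ContinuousLinearMap.proj (R := ℝ) (φ := fun _ : ι => E) j) := by
  refine ⟨(continuous_apply j).continuousAt, ?_⟩
  refine HasFDerivWithinAt.congr_of_eventuallyEq (f := fun y : ι → E => y j)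
    (ContinuousLinearMap.proj (R := ℝ) (φ := fun _ : ι => E) j).hasFDerivWithinAt ?_ ?_
  · filter_upwards [extChartAt_target_mem_nhdsWithin
      (I := ModelWithCorners.pi fun _ : ι => 𝓘(ℝ, E)) g] with y hy
    exact (chartAt E (g j)).right_inv (hy.2 j trivial)
  · exact (chartAt E (g j)).right_inv (mem_chart_target E (g j))

lemma contMDiff_apply_pi {n : ℕ∞ω} [IsManifold 𝓘(ℝ, E) n G] (j : ι) :
    ContMDiff (ModelWithCorners.pi fun _ : ι => 𝓘(ℝ, E)) 𝓘(ℝ, E) n (fun h : ι → G => h j) := by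
  intro g
  rw [contMDiffAt_iff]
  refine ⟨(continuous_apply j).continuousAt, ?_⟩
  refine ContDiffWithinAt.congr_of_eventuallyEq (f := fun y : ι → E => y j)
    (contDiff_apply ℝ E j).contDiffWithinAt ?_ ?_
  · filter_upwards [extChartAt_target_mem_nhdsWithin
      (I := ModelWithCorners.pi fun _ : ι => 𝓘(ℝ, E)) g] with y hy
    exact (chartAt E (g j)).right_inv (hy.2 j trivial)
  · exact (chartAt E (g j)).right_inv (mem_chart_target E (g j))

end PiManifold

/-! ### Exterior derivatives of forms which become `∑ hⱼ dFⱼ` after an injective linear map -/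

-- This is `d(h dF) = dh ∧ dF`: the terms with second derivatives of `F` cancel by symmetry. The
-- left inverse `P` recovers `α` from the right-hand side and so makes it differentiable, which the
-- formula for `extDeriv` requires.
open ContinuousAlternatingMap in
lemma map_extDeriv_of_eq_sum_mul_fderiv {B E A ι : Type*} [NormedAddCommGroup B] [NormedSpace ℝ B]
    [NormedAddCommGroup E] [NormedSpace ℝ E] [NormedRing A] [NormedAlgebra ℝ A] [Fintype ι]
    (D : E →L[ℝ] A) (P : A →L[ℝ] E) (hP : ∀ e, P (D e) = e) (α : B → B [⋀^Fin 1]→L[ℝ] E)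
    (h F : ι → B → A) {x : B} (hh : ∀ j, DifferentiableAt ℝ (h j) x)
    (hF : ∀ j, ContDiffAt ℝ 2 (F j) x)
    (hα : ∀ᶠ y in nhds x, ∀ v, D (α y v) = ∑ j, h j y * fderiv ℝ (F j) y (v 0)) (v : Fin 2 → B) :
    D (extDeriv α x v) = ∑ j, (fderiv ℝ (h j) x (v 0) * fderiv ℝ (F j) x (v 1) -
      fderiv ℝ (h j) x (v 1) * fderiv ℝ (F j) x (v 0)) := by
  have hdF : ∀ j, DifferentiableAt ℝ (fderiv ℝ (F j)) x := fun j =>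
    ((hF j).fderiv_right (m := 1) (by norm_num)).differentiableAt one_ne_zero
  let η : B → B →L[ℝ] A := fun y =>
    ∑ j, (ContinuousLinearMap.mul ℝ A (h j y)).comp (fderiv ℝ (F j) y)
  have hη : DifferentiableAt ℝ η x := DifferentiableAt.fun_sum fun j _ =>
    DifferentiableAt.clm_comp ((ContinuousLinearMap.mul ℝ A).differentiableAt.comp x (hh j)) (hdF j)
  have hαη : α =ᶠ[nhds x] fun y =>
      P.compContinuousAlternatingMap (ofSubsingleton ℝ B A (0 : Fin 1) (η y)) := by
    filter_upwards [hα] with y hy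
    ext v
    have := congrArg P (hy v)
    rw [hP] at this
    simp [this, η]
  have hαd : DifferentiableAt ℝ α x := by
    refine DifferentiableAt.congr_of_eventuallyEq ?_ hαη
    have h1 := (ofSubsingletonLIE (𝕜 := ℝ) (E := B) (F := A)
      (0 : Fin 1)).toContinuousLinearEquiv.differentiableAt.comp x hη
    exact (P.compContinuousAlternatingMapCLM ℝ B A E (Fin 1)).differentiableAt.comp x h1
  have hd : ∀ w w' : B, D (fderiv ℝ (fun y => α y (fun _ => w)) x w') =
      ∑ j, (fderiv ℝ (h j) x w' * fderiv ℝ (F j) x w +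
        h j x * fderiv ℝ (fderiv ℝ (F j)) x w' w) := by
    intro w w'
    have hαw : DifferentiableAt ℝ (fun y => α y (fun _ => w)) x :=
      (ContinuousAlternatingMap.apply ℝ B E (fun _ : Fin 1 => w)).differentiableAt.comp x hαd
    have h1 : HasFDerivAt (fun y => D (α y (fun _ => w)))
        (D.comp (fderiv ℝ (fun y => α y (fun _ => w)) x)) x :=
      D.hasFDerivAt.comp x hαw.hasFDerivAt
    have h2 : HasFDerivAt (fun y => ∑ j, h j y * fderiv ℝ (F j) y w)
        (∑ j, (h j x • ((fderiv ℝ (fderiv ℝ (F j)) x).flip w) +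
          MulOpposite.op (fderiv ℝ (F j) x w) • fderiv ℝ (h j) x)) x :=
      HasFDerivAt.fun_sum fun j _ => (hh j).hasFDerivAt.mul'
        ((ContinuousLinearMap.apply ℝ A w).hasFDerivAt.comp x (hdF j).hasFDerivAt)
    have h3 := h1.unique (h2.congr_of_eventuallyEq (hα.mono fun y hy => hy fun _ => w))
    have h4 := congrArg (fun T : B →L[ℝ] A => T w') h3
    simp only [ContinuousLinearMap.comp_apply] at h4
    rw [h4]
    simp only [_root_.sum_apply, _root_.add_apply,
      _root_.smul_apply, ContinuousLinearMap.flip_apply, smul_eq_mul,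
      op_smul_eq_mul]
    exact Finset.sum_congr rfl fun j _ => add_comm _ _
  rw [extDeriv_apply hαd, Fin.sum_univ_two]
  have e0 : (0 : Fin 2).removeNth v = fun _ => v 1 := by
    ext i; fin_cases i; rfl
  have e1 : (1 : Fin 2).removeNth v = fun _ => v 0 := by
    ext i; fin_cases i; rfl
  rw [e0, e1]
  simp only [Fin.val_zero, pow_zero, one_smul, Fin.val_one, pow_one, neg_smul, map_add, map_neg, hd]
  rw [← sub_eq_add_neg, ← Finset.sum_sub_distrib]
  refine Finset.sum_congr rfl fun j _ => ?_
  have hs : fderiv ℝ (fderiv ℝ (F j)) x (v 0) (v 1) = fderiv ℝ (fderiv ℝ (F j)) x (v 1) (v 0) :=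
    ((hF j).isSymmSndFDerivAt (by simp)) (v 0) (v 1)
  rw [hs]
  abel

/-! ### Vector-valued functions on a manifold, read in a chart -/

section Manifold

variable {B : Type*} [NormedAddCommGroup B] [NormedSpace ℝ B]
  {H : Type*} [TopologicalSpace H] {I : ModelWithCorners ℝ B H}
  {M : Type*} [TopologicalSpace M] [ChartedSpace H M]
  {A : Type*} [NormedAddCommGroup A] [NormedSpace ℝ A]

variable (I) in
/-- The derivative of a vector-valued function on a manifold. -/
noncomputable def vecDeriv (F : M → A) (x : M) : B →L[ℝ] A :=
  mfderiv I 𝓘(ℝ, A) F x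

variable [I.Boundaryless] [IsManifold I ∞ M]

lemma contDiffAt_comp_extChartAt_symm {F : M → A} (hF : ContMDiff I 𝓘(ℝ, A) ∞ F) (x : M) :
    ContDiffAt ℝ ∞ (F ∘ (extChartAt I x).symm) (extChartAt I x x) := by
  have h1 := hF.comp_contMDiffOn (contMDiffOn_extChartAt_symm (I := I) (n := ∞) x)
  exact (contMDiffOn_iff_contDiffOn.1 h1).contDiffAt (extChartAt_target_mem_nhds x)

lemma fderiv_comp_extChartAt_symm {F : M → A} (hF : ContMDiff I 𝓘(ℝ, A) ∞ F) (x : M) {y : B}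
    (hy : y ∈ (extChartAt I x).target) (w : B) :
    fderiv ℝ (F ∘ (extChartAt I x).symm) y w = vecDeriv I F ((extChartAt I x).symm y)
      (mfderivWithin 𝓘(ℝ, B) I (extChartAt I x).symm (Set.range I) y w) := by
  have : IsManifold I 1 M := IsManifold.of_le (n := ∞) (by simp)
  have h1 := (contMDiffOn_extChartAt_symm (I := I) (n := ∞) x).contMDiffAt
    (extChartAt_target_mem_nhds' hy)
  rw [I.range_eq_univ, mfderivWithin_univ, ← mfderiv_eq_fderiv,
    mfderiv_comp y (hF.mdifferentiableAt (by simp)) (h1.mdifferentiableAt (by simp))]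
  rfl

lemma vecDeriv_eq_fderiv_comp {F : M → A} (hF : ContMDiff I 𝓘(ℝ, A) ∞ F) (x : M)
    (w : B) :
    vecDeriv I F x w = fderiv ℝ (F ∘ (extChartAt I x).symm) (extChartAt I x x)
      (vecDeriv I (extChartAt I x) x w) := by
  have : IsManifold I 1 M := IsManifold.of_le (n := ∞) (by simp)
  have h1 := (contDiffAt_comp_extChartAt_symm hF x).differentiableAt (by simp)
  have h2 : F =ᶠ[nhds x] (F ∘ (extChartAt I x).symm) ∘ extChartAt I x := by
    filter_upwards [extChartAt_source_mem_nhds (I := I) x] with y hy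
    exact congrArg F ((extChartAt I x).left_inv hy).symm
  rw [vecDeriv, h2.mfderiv_eq, mfderiv_comp x h1.mdifferentiableAt
    (mdifferentiableAt_extChartAt (mem_chart_source H x)), mfderiv_eq_fderiv]
  rfl

end Manifold

/-- A differential form read in the preferred chart at `x`. -/
noncomputable def formInChart {B : Type*} [NormedAddCommGroup B] [NormedSpace ℝ B]
    {H : Type*} [TopologicalSpace H] {I : ModelWithCorners ℝ B H}
    {M : Type*} [TopologicalSpace M] [ChartedSpace H M]
    {F : Type*} [NormedAddCommGroup F] [NormedSpace ℝ F] {k : ℕ}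
    (θ : ∀ x : M, TangentSpace I x [⋀^Fin k]→L[ℝ] F) (x : M) (y : B) : B [⋀^Fin k]→L[ℝ] F :=
  (θ ((extChartAt I x).symm y)).compContinuousLinearMap
    (mfderivWithin 𝓘(ℝ, B) I (extChartAt I x).symm (Set.range I) y)

section ManifoldAlgebra

variable {B : Type*} [NormedAddCommGroup B] [NormedSpace ℝ B]
  {H : Type*} [TopologicalSpace H] {I : ModelWithCorners ℝ B H} [I.Boundaryless]
  {M : Type*} [TopologicalSpace M] [ChartedSpace H M] [IsManifold I ∞ M]
  {E A ι : Type*} [NormedAddCommGroup E] [NormedSpace ℝ E] [NormedRing A] [NormedAlgebra ℝ A]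
  [Fintype ι]

/-- The exterior derivative at `x` is taken in the chart at `x`, where the hypothesis turns into the
one of the vector space version. -/
lemma map_mextDeriv_of_eq_sum_mul_vecDeriv
    (D : E →L[ℝ] A) (P : A →L[ℝ] E) (hP : ∀ e, P (D e) = e)
    (θ : ∀ x : M, TangentSpace I x [⋀^Fin 1]→L[ℝ] E)
    (h F : ι → M → A) (hh : ∀ j, ContMDiff I 𝓘(ℝ, A) ∞ (h j))
    (hF : ∀ j, ContMDiff I 𝓘(ℝ, A) ∞ (F j))
    (hθ : ∀ (x : M) (v : Fin 1 → B), D (θ x v) = ∑ j, h j x * vecDeriv I (F j) x (v 0)) (x : M)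
    (v : Fin 2 → B) :
    D (mextDeriv I θ x v) = ∑ j, (vecDeriv I (h j) x (v 0) * vecDeriv I (F j) x (v 1) -
      vecDeriv I (h j) x (v 1) * vecDeriv I (F j) x (v 0)) := by
  have e : mextDeriv I θ x v = extDerivWithin (formInChart θ x) (Set.range I) (extChartAt I x x)
      (fun i => vecDeriv I (extChartAt I x) x (v i)) := rfl
  rw [e, I.range_eq_univ, extDerivWithin_univ]
  rw [map_extDeriv_of_eq_sum_mul_fderiv D P hP _
    (fun j => h j ∘ (extChartAt I x).symm) (fun j => F j ∘ (extChartAt I x).symm)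
    (fun j => (contDiffAt_comp_extChartAt_symm (hh j) x).differentiableAt (by simp))
    (fun j => (contDiffAt_comp_extChartAt_symm (hF j) x).of_le ENat.LEInfty.out)]
  · simp only [vecDeriv_eq_fderiv_comp (hh _), vecDeriv_eq_fderiv_comp (hF _)]
  · filter_upwards [extChartAt_target_mem_nhds (I := I) x] with y hy w
    have e : formInChart θ x y w = θ ((extChartAt I x).symm y)
      (fun i => mfderivWithin 𝓘(ℝ, B) I (extChartAt I x).symm (Set.range I) y (w i)) := rfl
    rw [e]
    refine (hθ _ _).trans ?_
    exact Finset.sum_congr rfl fun j _ => by rw [fderiv_comp_extChartAt_symm (hF j) x hy]; rfl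

end ManifoldAlgebra

/-! ### Chain rules for vector-valued functions -/

section ChainRule

variable {B : Type*} [NormedAddCommGroup B] [NormedSpace ℝ B]
  {H : Type*} [TopologicalSpace H] {I : ModelWithCorners ℝ B H}
  {M : Type*} [TopologicalSpace M] [ChartedSpace H M]
  {E : Type*} [NormedAddCommGroup E] [NormedSpace ℝ E]
  {G : Type*} [TopologicalSpace G] [ChartedSpace E G]
  {A : Type*} [NormedRing A] [NormedAlgebra ℝ A]

lemma vecDeriv_const_mul {F : M → A} {x : M} (hF : MDifferentiableAt I 𝓘(ℝ, A) F x) (c : A)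
    (w : B) :
    vecDeriv I (fun y => c * F y) x w = c * vecDeriv I F x w := by
  have h1 : HasMFDerivAt 𝓘(ℝ, A) 𝓘(ℝ, A) (fun a : A => c * a) (F x)
      (ContinuousLinearMap.mul ℝ A c) :=
    (ContinuousLinearMap.mul ℝ A c).hasFDerivAt.hasMFDerivAt
  have h2 := (h1.comp x hF.hasMFDerivAt).mfderiv
  exact congrArg (fun T : B →L[ℝ] A => T w) h2

lemma vecDeriv_mul_const {F : M → A} {x : M} (hF : MDifferentiableAt I 𝓘(ℝ, A) F x) (c : A)
    (w : B) :
    vecDeriv I (fun y => F y * c) x w = vecDeriv I F x w * c := by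
  have h1 : HasMFDerivAt 𝓘(ℝ, A) 𝓘(ℝ, A) (fun a : A => a * c) (F x)
      ((ContinuousLinearMap.mul ℝ A).flip c) :=
    ((ContinuousLinearMap.mul ℝ A).flip c).hasFDerivAt.hasMFDerivAt
  have h2 := (h1.comp x hF.hasMFDerivAt).mfderiv
  exact congrArg (fun T : B →L[ℝ] A => T w) h2

lemma vecDeriv_comp {F : G → A} {f : M → G} {x : M}
    (hF : MDifferentiableAt 𝓘(ℝ, E) 𝓘(ℝ, A) F (f x))
    (hf : MDifferentiableAt I 𝓘(ℝ, E) f x) (w : B) :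
    vecDeriv I (fun y => F (f y)) x w = vecDeriv 𝓘(ℝ, E) F (f x) (mfderiv I 𝓘(ℝ, E) f x w) := by
  have h2 := (hF.hasMFDerivAt.comp x hf.hasMFDerivAt).mfderiv
  exact congrArg (fun T : B →L[ℝ] A => T w) h2

lemma vecDeriv_congr_point {F : G → A} {g h : G} (e : g = h) (w : E) :
    vecDeriv 𝓘(ℝ, E) F g w = vecDeriv 𝓘(ℝ, E) F h w := by
  subst e; rfl

end ChainRule

/-! ### Smooth homomorphisms from a Lie group to the units of a normed algebra -/

section Homomorphism

variable {E : Type*} [NormedAddCommGroup E] [NormedSpace ℝ E]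
  {G : Type*} [TopologicalSpace G] [ChartedSpace E G] [Group G] [LieGroup 𝓘(ℝ, E) ∞ G]
  {A : Type*} [NormedRing A] [NormedAlgebra ℝ A]

variable (E) in
/-- The derivative at `1` of a map from a Lie group to a vector space. -/
noncomputable def derivOne (R : G → A) : E →L[ℝ] A := vecDeriv 𝓘(ℝ, E) R (1 : G)

/-- The `A`-valued `1`-form `D ∘ ω`, where `ω` is the Maurer-Cartan form and `D` the derivative at `1`
of a map to `A`. -/
noncomputable def linMaurerCartan (R : G → A) (g : G) : E →L[ℝ] A :=
  (derivOne E R).comp (maurerCartan E g)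

/-- Differentiating `R (g⁻¹ y) = R g⁻¹ * R y` at `y = g` gives the classical expression `R⁻¹ dR`. -/
lemma linMaurerCartan_apply (R : G →* A) (hR : ContMDiff 𝓘(ℝ, E) 𝓘(ℝ, A) ∞ R) (g : G)
    (v : E) : linMaurerCartan R g v = R g⁻¹ * vecDeriv 𝓘(ℝ, E) R g v := by
  rw [← vecDeriv_const_mul (hR.mdifferentiableAt (by simp))]
  have e : (fun y => R g⁻¹ * R y) = fun y => R (g⁻¹ * y) := by simp
  rw [e, vecDeriv_comp (F := R) (f := fun y => g⁻¹ * y) (hR.mdifferentiableAt (by simp))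
    ((contMDiff_mul_left (I := 𝓘(ℝ, E)) (n := ∞)).mdifferentiableAt (by simp))]
  exact vecDeriv_congr_point (inv_mul_cancel g).symm _

lemma vecDeriv_mulInvariantVectorField (R : G →* A) (hR : ContMDiff 𝓘(ℝ, E) 𝓘(ℝ, A) ∞ R)
    (X : E) (g : G) :
    vecDeriv 𝓘(ℝ, E) R g
      (mulInvariantVectorField (I := 𝓘(ℝ, E)) (G := G) X g) = R g * derivOne E R X := by
  have h1 := vecDeriv_const_mul (hR.mdifferentiableAt (x := (1 : G)) (by simp)) (R g) X
  refine Eq.trans ?_ h1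
  have e : (fun y => R g * R y) = fun y => R (g * y) := by simp
  rw [e, vecDeriv_comp (F := R) (f := fun y => g * y) (hR.mdifferentiableAt (by simp))
    ((contMDiff_mul_left (I := 𝓘(ℝ, E)) (n := ∞)).mdifferentiableAt (by simp))]
  exact vecDeriv_congr_point (mul_one g).symm _

lemma derivOne_adjoint (R : G →* A) (hR : ContMDiff 𝓘(ℝ, E) 𝓘(ℝ, A) ∞ R) (g : G)
    (X : E) : derivOne E R (adjoint E g X) = R g * derivOne E R X * R g⁻¹ := by
  have hd := hR.mdifferentiableAt (x := (1 : G)) (by simp)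
  have h1 := vecDeriv_const_mul hd (R g) X
  have h2 := vecDeriv_mul_const (F := fun y => R g * R y) (x := (1 : G))
    (((ContinuousLinearMap.mul ℝ A (R g)).contMDiff.comp hR).mdifferentiableAt (by simp)) (R g⁻¹) X
  rw [h1] at h2
  refine Eq.trans ?_ h2
  have e : (fun y => R g * R y * R g⁻¹) = fun y => R (g * y * g⁻¹) := by simp
  rw [e, vecDeriv_comp (F := R) (f := fun y => g * y * g⁻¹) (hR.mdifferentiableAt (by simp))
    (((contMDiff_const.mul contMDiff_id).mul contMDiff_const :
      ContMDiff 𝓘(ℝ, E) 𝓘(ℝ, E) ∞ (fun y => g * y * g⁻¹)).mdifferentiableAt (by simp))]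
  exact vecDeriv_congr_point (by simp) _

/-- The invariant vector field of `X`, read in the chart at `1`. -/
noncomputable def invariantFieldInChart (X : GroupLieAlgebra 𝓘(ℝ, E) G) : E → E :=
  VectorField.mpullbackWithin 𝓘(ℝ, E) 𝓘(ℝ, E) (extChartAt 𝓘(ℝ, E) (1 : G)).symm
    (mulInvariantVectorField X) (Set.range 𝓘(ℝ, E))

lemma differentiableAt_invariantFieldInChart [CompleteSpace E] (X : GroupLieAlgebra 𝓘(ℝ, E) G) :
    DifferentiableAt ℝ (invariantFieldInChart X) (extChartAt 𝓘(ℝ, E) (1 : G) 1) := by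
  have : LieGroup 𝓘(ℝ, E) (minSmoothness ℝ 3) G :=
    LieGroup.of_le (n := ∞) (by rw [minSmoothness_of_isRCLikeNormedField]; exact ENat.LEInfty.out)
  have : IsManifold 𝓘(ℝ, E) 2 G := IsManifold.of_le (n := ∞) ENat.LEInfty.out
  have h := (mdifferentiableAt_mulInvariantVectorField X
    (g := (1 : G))).mdifferentiableWithinAt (s := Set.univ)
  have h' := h.differentiableWithinAt_mpullbackWithin_vectorField
  rw [← differentiableWithinAt_univ, invariantFieldInChart]
  rw [Set.preimage_univ, Set.univ_inter] at h'
  simpa only [ModelWithCorners.range_eq_univ] using h'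

lemma fderiv_invariantFieldInChart (R : G →* A) (hR : ContMDiff 𝓘(ℝ, E) 𝓘(ℝ, A) ∞ R)
    (X : GroupLieAlgebra 𝓘(ℝ, E) G) {y : E} (hy : y ∈ (extChartAt 𝓘(ℝ, E) (1 : G)).target) :
    fderiv ℝ (R ∘ (extChartAt 𝓘(ℝ, E) (1 : G)).symm) y (invariantFieldInChart X y) =
      R ((extChartAt 𝓘(ℝ, E) (1 : G)).symm y) * derivOne E R X := by
  have : IsManifold 𝓘(ℝ, E) 1 G := IsManifold.of_le (n := ∞) (by simp)
  rw [fderiv_comp_extChartAt_symm hR 1 hy]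
  refine Eq.trans ?_ (vecDeriv_mulInvariantVectorField R hR X _)
  congr 1
  exact (isInvertible_mfderivWithin_extChartAt_symm hy).self_apply_inverse _

/-- In the chart at `1`, with `F` for `R` and `V_Z` for the invariant field of `Z`, invariance says
`dF(V_Z) = F · D Z`. Differentiating this for `Z = Y` along `V_X` and for `Z = X` along `V_Y` and
subtracting cancels the second derivatives of `F`; what remains is `dF [V_X, V_Y]` on one side and
the commutator on the other, as `F = 1` at the base point. -/
lemma derivOne_bracket [CompleteSpace E] (R : G →* A) (hR : ContMDiff 𝓘(ℝ, E) 𝓘(ℝ, A) ∞ R)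
    (X Y : GroupLieAlgebra 𝓘(ℝ, E) G) :
    derivOne E R (⁅X, Y⁆ : GroupLieAlgebra 𝓘(ℝ, E) G) =
      derivOne E R X * derivOne E R Y - derivOne E R Y * derivOne E R X := by
  have : IsManifold 𝓘(ℝ, E) 1 G := IsManifold.of_le (n := ∞) (by simp)
  set c := extChartAt 𝓘(ℝ, E) (1 : G) with hc
  set F : E → A := R ∘ c.symm with hF
  set x := c 1 with hx
  have hFs : ContDiffAt ℝ ∞ F x := contDiffAt_comp_extChartAt_symm hR 1
  have hxt : x ∈ c.target := mem_extChartAt_target (I := 𝓘(ℝ, E)) (1 : G)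
  have hxs : c.symm x = 1 := extChartAt_to_inv (I := 𝓘(ℝ, E)) (1 : G)
  have e1 : derivOne E R (⁅X, Y⁆ : GroupLieAlgebra 𝓘(ℝ, E) G) = fderiv ℝ F x
      (VectorField.lieBracket ℝ (invariantFieldInChart X) (invariantFieldInChart Y) x) := by
    refine (vecDeriv_eq_fderiv_comp hR (1 : G) (⁅X, Y⁆ : GroupLieAlgebra 𝓘(ℝ, E) G)).trans ?_
    congr 1
    rw [GroupLieAlgebra.bracket_def, ← VectorField.mlieBracketWithin_univ,
      VectorField.mlieBracketWithin_apply]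
    -- The bracket on the manifold is pulled back from the chart, so the derivative of the chart
    -- cancels the pullback.
    refine ((isInvertible_mfderiv_extChartAt
      (mem_extChartAt_source (I := 𝓘(ℝ, E)) (1 : G))).self_apply_inverse _).trans ?_
    change VectorField.lieBracketWithin ℝ (invariantFieldInChart X) (invariantFieldInChart Y)
      (c.symm ⁻¹' Set.univ ∩ Set.range 𝓘(ℝ, E)) x = _
    rw [Set.preimage_univ, Set.univ_inter, ModelWithCorners.range_eq_univ,
      VectorField.lieBracketWithin_univ]
  have hdF : DifferentiableAt ℝ (fderiv ℝ F) x :=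
    ((hFs.of_le ENat.LEInfty.out).fderiv_right (m := 1) (n := 2)
      (by norm_num)).differentiableAt one_ne_zero
  have key : ∀ (Z : GroupLieAlgebra 𝓘(ℝ, E) G) (w : E),
      fderiv ℝ F x (fderiv ℝ (invariantFieldInChart Z) x w) +
        fderiv ℝ (fderiv ℝ F) x w (invariantFieldInChart Z x) =
      fderiv ℝ F x w * derivOne E R Z := by
    intro Z w
    have h1 := hdF.hasFDerivAt.clm_apply (differentiableAt_invariantFieldInChart Z).hasFDerivAt
    have h2 : HasFDerivAt (fun y => F y * derivOne E R Z)
        (((ContinuousLinearMap.mul ℝ A).flip (derivOne E R Z)).comp (fderiv ℝ F x)) x :=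
      ((ContinuousLinearMap.mul ℝ A).flip (derivOne E R Z)).hasFDerivAt.comp x
        (hFs.differentiableAt (by simp)).hasFDerivAt
    have h3 : (fun y => fderiv ℝ F y (invariantFieldInChart Z y)) =ᶠ[nhds x]
        fun y => F y * derivOne E R Z := by
      filter_upwards [extChartAt_target_mem_nhds (I := 𝓘(ℝ, E)) (1 : G)] with y hy
      exact fderiv_invariantFieldInChart R hR Z hy
    have h4 := congrArg (fun T : E →L[ℝ] A => T w) (h1.unique (h2.congr_of_eventuallyEq h3))
    exact h4
  have hV : ∀ Z : GroupLieAlgebra 𝓘(ℝ, E) G,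
      fderiv ℝ F x (invariantFieldInChart Z x) = derivOne E R Z := by
    intro Z
    have h := fderiv_invariantFieldInChart R hR Z hxt
    rwa [hxs, map_one, one_mul] at h
  have hs : fderiv ℝ (fderiv ℝ F) x (invariantFieldInChart X x) (invariantFieldInChart Y x) =
      fderiv ℝ (fderiv ℝ F) x (invariantFieldInChart Y x) (invariantFieldInChart X x) :=
    ((hFs.of_le (n := ∞) (m := 2) ENat.LEInfty.out).isSymmSndFDerivAt (by simp)) _ _
  rw [e1, VectorField.lieBracket, map_sub, eq_sub_of_add_eq (key Y _), eq_sub_of_add_eq (key X _),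
    hs, hV, hV]
  abel

end Homomorphism

/-! ### Derivatives of products and inverses -/

section ProductRule

variable {B : Type*} [NormedAddCommGroup B] [NormedSpace ℝ B]
  {H : Type*} [TopologicalSpace H] {I : ModelWithCorners ℝ B H}
  {M : Type*} [TopologicalSpace M] [ChartedSpace H M]
  {A : Type*} [NormedRing A] [NormedAlgebra ℝ A]

lemma vecDeriv_mul {F K : M → A} {x : M} (hF : MDifferentiableAt I 𝓘(ℝ, A) F x)
    (hK : MDifferentiableAt I 𝓘(ℝ, A) K x) (w : B) :
    vecDeriv I (fun y => F y * K y) x w = F x * vecDeriv I K x w + vecDeriv I F x w * K x := by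
  have h := (hF.hasMFDerivAt.mul' hK.hasMFDerivAt).mfderiv
  exact congrArg (fun T : B →L[ℝ] A => T w) h

/-- The derivative of the inverse: if `S F = 1` and `F S = 1` then `dS = -S dF S`. -/
lemma vecDeriv_of_mul_eq_one {S F : M → A} {x : M} (hS : MDifferentiableAt I 𝓘(ℝ, A) S x)
    (hF : MDifferentiableAt I 𝓘(ℝ, A) F x) (h1 : ∀ y, S y * F y = 1) (h2 : ∀ y, F y * S y = 1)
    (w : B) : vecDeriv I S x w = -(S x * vecDeriv I F x w * S x) := by
  have h := vecDeriv_mul hS hF w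
  have h0 : vecDeriv I (fun y => S y * F y) x w = 0 := by
    have e : (fun y => S y * F y) = fun _ => (1 : A) := funext h1
    rw [e, vecDeriv, mfderiv_const]
    rfl
  rw [h0] at h
  have h3 := congrArg (fun a => a * S x) h
  simp only [zero_mul, add_mul, mul_assoc, h2, mul_one] at h3
  rw [mul_assoc]
  exact eq_neg_of_add_eq_zero_right h3.symm

end ProductRule

/-! ### The curvature of the canonical connection -/

/-- The derivative of the barycentric coordinates in the direction `v`. -/
def baryDeriv {n : ℕ} (v : Fin n → ℝ) : Fin (n + 1) → ℝ := Fin.cons (-∑ i, v i) v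

/-- The `j`-th component of `baryDeriv` as a linear map. -/
noncomputable def baryDerivCLM (n : ℕ) (j : Fin (n + 1)) : (Fin n → ℝ) →L[ℝ] ℝ :=
  Fin.cases (-∑ i, ContinuousLinearMap.proj i) (fun i => ContinuousLinearMap.proj i) j

lemma baryDerivCLM_apply {n : ℕ} (j : Fin (n + 1)) (v : Fin n → ℝ) :
    baryDerivCLM n j v = baryDeriv v j := by
  refine Fin.cases ?_ (fun i => ?_) j <;> simp [baryDerivCLM, baryDeriv]

lemma hasFDerivAt_barycentric {n : ℕ} (j : Fin (n + 1)) (t : Fin n → ℝ) :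
    HasFDerivAt (fun t => barycentric t j) (baryDerivCLM n j) t := by
  refine Fin.cases ?_ (fun i => ?_) j
  · have h : HasFDerivAt (fun t : Fin n → ℝ => 1 - ∑ i, t i)
        (-∑ i, ContinuousLinearMap.proj (R := ℝ) (φ := fun _ : Fin n => ℝ) i) t :=
      (HasFDerivAt.fun_sum fun i _ => hasFDerivAt_apply i t).const_sub 1
    simpa [barycentric, baryDerivCLM] using h
  · simpa [barycentric, baryDerivCLM] using hasFDerivAt_apply (𝕜 := ℝ) i t

lemma contDiff_barycentric {n : ℕ} (j : Fin (n + 1)) :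
    ContDiff ℝ ∞ (fun t : Fin n → ℝ => barycentric t j) := by
  refine Fin.cases ?_ (fun i => ?_) j
  · simp only [barycentric, Fin.cons_zero]
    fun_prop
  · simp only [barycentric, Fin.cons_succ]
    fun_prop

/-- The value of the curvature of `∑ tⱼ ωⱼ` for flat `ωⱼ`, on two tangent vectors on which `dtⱼ`
takes the values `τ j`, `τ' j` and `ωⱼ` takes the values `a j`, `a' j`. -/
def curvatureValue {m : ℕ} {A : Type*} [Ring A] [Module ℝ A] (t τ τ' : Fin m → ℝ)
    (a a' : Fin m → A) : A :=
  ∑ j, (τ j • a' j - τ' j • a j - t j • (a j * a' j - a' j * a j)) +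
    ((∑ j, t j • a j) * (∑ j, t j • a' j) - (∑ j, t j • a' j) * (∑ j, t j • a j))

section Barycentric

variable {E : Type*} [NormedAddCommGroup E] [NormedSpace ℝ E]
  {G : Type*} [TopologicalSpace G] [ChartedSpace E G]
  {A : Type*} [NormedRing A] [NormedAlgebra ℝ A]

lemma contMDiff_total_barycentric (n : ℕ) (j : Fin (n + 1)) :
    ContMDiff (totalModel E n) 𝓘(ℝ, A) ∞
      (fun q : (Fin n → ℝ) × (Fin (n + 1) → G) => algebraMap ℝ A (barycentric q.1 j)) :=
  ((algebraMapCLM ℝ A).contDiff.comp (contDiff_barycentric j)).contMDiff.comp contMDiff_fst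

lemma vecDeriv_total_barycentric (n : ℕ) (j : Fin (n + 1))
    (p : (Fin n → ℝ) × (Fin (n + 1) → G)) (w : (Fin n → ℝ) × (Fin (n + 1) → E)) :
    vecDeriv (totalModel E n)
      (fun q : (Fin n → ℝ) × (Fin (n + 1) → G) => algebraMap ℝ A (barycentric q.1 j)) p w =
      algebraMap ℝ A (baryDeriv w.1 j) := by
  have h1 : HasFDerivAt (fun t : Fin n → ℝ => algebraMap ℝ A (barycentric t j))
      ((algebraMapCLM ℝ A).comp (baryDerivCLM n j)) p.1 :=
    (algebraMapCLM ℝ A).hasFDerivAt.comp p.1 (hasFDerivAt_barycentric j p.1)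
  have h := (h1.hasMFDerivAt.comp p
    (hasMFDerivAt_fst (I := 𝓘(ℝ, Fin n → ℝ))
      (I' := ModelWithCorners.pi fun _ : Fin (n + 1) => 𝓘(ℝ, E)) p)).mfderiv
  rw [← baryDerivCLM_apply]
  exact congrArg (fun T : ((Fin n → ℝ) × (Fin (n + 1) → E)) →L[ℝ] A => T w) h

lemma derivOne_canonicalConnection [Group G] (R : G →* A) (n : ℕ)
    (q : (Fin n → ℝ) × (Fin (n + 1) → G)) (w : (Fin n → ℝ) × (Fin (n + 1) → E)) :
    derivOne E R (canonicalConnection E n q w) =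
      ∑ j, barycentric q.1 j • linMaurerCartan R (q.2 j) (w.2 j) := by
  have e : canonicalConnection E n q w =
      ∑ j, barycentric q.1 j • (maurerCartan E (q.2 j) : E →L[ℝ] E) (w.2 j) := by
    unfold canonicalConnection
    exact _root_.sum_apply _ _ w
  refine (congrArg (derivOne E R) e).trans ((map_sum (derivOne E R) _ _).trans ?_)
  exact Finset.sum_congr rfl fun j _ => map_smul (derivOne E R) _ _

end Barycentric

lemma sum_perm_fin_two {X : Type*} [AddCommMonoid X] (f : Equiv.Perm (Fin 2) → X) :
    ∑ σ, f σ = f 1 + f (Equiv.swap 0 1) := by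
  have h : (Finset.univ : Finset (Equiv.Perm (Fin 2))) = {1, Equiv.swap 0 1} := by decide
  rw [h, Finset.sum_pair (by decide)]

section Curvature

variable {E : Type*} [NormedAddCommGroup E] [NormedSpace ℝ E]
  {G : Type*} [TopologicalSpace G] [ChartedSpace E G] [Group G] [LieGroup 𝓘(ℝ, E) ∞ G]
  {A : Type*} [NormedRing A] [NormedAlgebra ℝ A]

lemma contMDiff_total_apply (n : ℕ) (j : Fin (n + 1)) :
    ContMDiff (totalModel E n) 𝓘(ℝ, E) ∞ (fun q : (Fin n → ℝ) × (Fin (n + 1) → G) => q.2 j) :=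
  (contMDiff_apply_pi j).comp contMDiff_snd

lemma vecDeriv_comp_total_apply {F : G → A} (hF : ContMDiff 𝓘(ℝ, E) 𝓘(ℝ, A) ∞ F) (n : ℕ)
    (j : Fin (n + 1)) (p : (Fin n → ℝ) × (Fin (n + 1) → G)) (w : (Fin n → ℝ) × (Fin (n + 1) → E)) :
    vecDeriv (totalModel E n) (fun q : (Fin n → ℝ) × (Fin (n + 1) → G) => F (q.2 j)) p w =
      vecDeriv 𝓘(ℝ, E) F (p.2 j) (w.2 j) := by
  rw [vecDeriv_comp (f := fun q : (Fin n → ℝ) × (Fin (n + 1) → G) => q.2 j)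
    (hF.mdifferentiableAt (by simp)) ((contMDiff_total_apply n j).mdifferentiableAt (by simp))]
  have h := ((hasMFDerivAt_apply (E := E) p.2 j).comp p
    (hasMFDerivAt_snd (I := 𝓘(ℝ, Fin n → ℝ))
      (I' := ModelWithCorners.pi fun _ : Fin (n + 1) => 𝓘(ℝ, E)) p)).mfderiv
  exact congrArg (fun T => vecDeriv 𝓘(ℝ, E) F (p.2 j) (T w)) h

/-- The two permutations contribute equal brackets, which the factor `1/2` compensates. -/
lemma derivOne_half_bracketWedge [CompleteSpace E] (R : G →* A)
    (hR : ContMDiff 𝓘(ℝ, E) 𝓘(ℝ, A) ∞ R) {T : Type*} (φ : T → GroupLieAlgebra 𝓘(ℝ, E) G)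
    (v : Fin 2 → T) :
    derivOne E R ((1 / 2 : ℝ) • bracketWedge φ φ v) =
      derivOne E R (φ (v 0)) * derivOne E R (φ (v 1)) -
        derivOne E R (φ (v 1)) * derivOne E R (φ (v 0)) := by
  have h : bracketWedge φ φ v = ⁅φ (v 0), φ (v 1)⁆ - ⁅φ (v 1), φ (v 0)⁆ := by
    simp [bracketWedge, sum_perm_fin_two, Units.smul_def, sub_eq_add_neg]
  have e : derivOne E R ((1 / 2 : ℝ) • (⁅φ (v 0), φ (v 1)⁆ - ⁅φ (v 1), φ (v 0)⁆)) =
      (1 / 2 : ℝ) • (derivOne E R (⁅φ (v 0), φ (v 1)⁆ : GroupLieAlgebra 𝓘(ℝ, E) G) -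
        derivOne E R (⁅φ (v 1), φ (v 0)⁆ : GroupLieAlgebra 𝓘(ℝ, E) G)) :=
    (map_smul (derivOne E R) _ _).trans (congrArg _ (map_sub (derivOne E R) _ _))
  rw [h]
  refine e.trans ?_
  rw [derivOne_bracket R hR, derivOne_bracket R hR]
  module

/-- The connection becomes `∑ hⱼ dFⱼ` with `Fⱼ = Rⱼ` and `hⱼ = tⱼ Rⱼ⁻¹`. In `dhⱼ ∧ dFⱼ`, the factor
`tⱼ` yields `dtⱼ ∧ aⱼ`, and `d(R⁻¹) = -R⁻¹ dR R⁻¹` yields `-tⱼ aⱼ ∧ aⱼ`. The bracket term supplies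
the square of the connection. -/
lemma derivOne_curvature [CompleteSpace E] (R : G →* A) (hR : ContMDiff 𝓘(ℝ, E) 𝓘(ℝ, A) ∞ R)
    (P : A →L[ℝ] E) (hP : ∀ e, P (derivOne E R e) = e) (n : ℕ)
    (p : (Fin n → ℝ) × (Fin (n + 1) → G)) (v : Fin 2 → (Fin n → ℝ) × (Fin (n + 1) → E)) :
    derivOne E R (curvature E n p v) =
      curvatureValue (barycentric p.1) (baryDeriv (v 0).1) (baryDeriv (v 1).1)
        (fun j => linMaurerCartan R (p.2 j) ((v 0).2 j))
        (fun j => linMaurerCartan R (p.2 j) ((v 1).2 j)) := by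
  let M := (Fin n → ℝ) × (Fin (n + 1) → G)
  have hRi : ContMDiff 𝓘(ℝ, E) 𝓘(ℝ, A) ∞ (fun g : G => R g⁻¹) := hR.comp (contMDiff_inv _ _)
  let b : Fin (n + 1) → M → A := fun j q => algebraMap ℝ A (barycentric q.1 j)
  let S : Fin (n + 1) → M → A := fun j q => R (q.2 j)⁻¹
  let F : Fin (n + 1) → M → A := fun j q => R (q.2 j)
  have hb : ∀ j, ContMDiff (totalModel E n) 𝓘(ℝ, A) ∞ (b j) := contMDiff_total_barycentric n
  have hS : ∀ j, ContMDiff (totalModel E n) 𝓘(ℝ, A) ∞ (S j) := fun j =>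
    hRi.comp (contMDiff_total_apply n j)
  have hF : ∀ j, ContMDiff (totalModel E n) 𝓘(ℝ, A) ∞ (F j) := fun j =>
    hR.comp (contMDiff_total_apply n j)
  have hmul : ContDiff ℝ ∞ (fun a : A × A => a.1 * a.2) := contDiff_mul
  have hbS : ∀ j, ContMDiff (totalModel E n) 𝓘(ℝ, A) ∞ (fun q => b j q * S j q) := fun j =>
    hmul.contMDiff.comp ((hb j).prodMk_space (hS j))
  have ha : ∀ (j : Fin (n + 1)) (q : M) (w : (Fin n → ℝ) × (Fin (n + 1) → E)),
      linMaurerCartan R (q.2 j) (w.2 j) =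
        S j q * vecDeriv (totalModel E n) (F j) q w := by
    intro j q w
    rw [linMaurerCartan_apply R hR, vecDeriv_comp_total_apply hR]
  have h1 := map_mextDeriv_of_eq_sum_mul_vecDeriv (I := totalModel E n) (derivOne E R) P hP
    (fun q : M => ContinuousAlternatingMap.ofSubsingleton ℝ (TangentSpace (totalModel E n) q) E
      (0 : Fin 1) (canonicalConnection E n q)) (fun j q => b j q * S j q) F hbS hF
    (fun q w => by
      refine (derivOne_canonicalConnection R n q (w 0)).trans (Finset.sum_congr rfl fun j _ => ?_)
      rw [ha, mul_assoc, Algebra.smul_def]) p v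
  have h2 : ∀ (j : Fin (n + 1)) (w w' : (Fin n → ℝ) × (Fin (n + 1) → E)),
      vecDeriv (totalModel E n) (fun q => b j q * S j q) p w *
        vecDeriv (totalModel E n) (F j) p w' =
      baryDeriv w.1 j • linMaurerCartan R (p.2 j) (w'.2 j) -
        barycentric p.1 j • (linMaurerCartan R (p.2 j) (w.2 j) *
          linMaurerCartan R (p.2 j) (w'.2 j)) := by
    intro j w w'
    rw [ha, ha, vecDeriv_mul ((hb j).mdifferentiableAt (by simp))
      ((hS j).mdifferentiableAt (by simp)), vecDeriv_total_barycentric,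
      vecDeriv_of_mul_eq_one ((hS j).mdifferentiableAt (by simp))
        ((hF j).mdifferentiableAt (by simp)) (fun q => by simp [S, F, ← map_mul])
        (fun q => by simp [S, F, ← map_mul]), Algebra.smul_def, Algebra.smul_def]
    simp only [b, mul_neg, add_mul, neg_mul, mul_assoc]
    abel
  have h3 := derivOne_half_bracketWedge R hR
    (fun w : (Fin n → ℝ) × (Fin (n + 1) → E) =>
      (canonicalConnection E n p w : GroupLieAlgebra 𝓘(ℝ, E) G)) v
  have h4 := derivOne_canonicalConnection R n p (v 0)
  have h5 := derivOne_canonicalConnection R n p (v 1)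
  refine (map_add (derivOne E R) _ _).trans ?_
  refine (congrArg₂ (· + ·) h1 (h3.trans (congrArg₂ (· - ·) (congrArg₂ (· * ·) h4 h5)
    (congrArg₂ (· * ·) h5 h4)))).trans ?_
  simp only [h2, curvatureValue]
  congr 1
  refine Finset.sum_congr rfl fun j _ => ?_
  rw [smul_sub]
  abel

end Curvature

/-! ### Sums over permutations -/

section Permutations

open Equiv

/-- A permutation is encoded by the image `i` of `0` and a permutation `e` of the rest: it is `e`,
extended by fixing `0`, followed by the swap of `0` and `i`. In the signed sums below, `i ≠ 0`
therefore costs a sign. -/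
lemma sum_perm_fin_succ {X : Type*} [AddCommMonoid X] {n : ℕ} (f : Perm (Fin (n + 1)) → X) :
    ∑ σ, f σ = ∑ i, ∑ e : Perm (Fin n), f (Perm.decomposeFin.symm (i, e)) := by
  rw [← Fintype.sum_prod_type']
  exact (Equiv.sum_comp Perm.decomposeFin.symm f).symm

lemma sum_sign_smul_perm_fin_two {X : Type*} [AddCommGroup X] (F : Fin 2 → Fin 2 → X) :
    ∑ σ : Perm (Fin 2), Perm.sign σ • F (σ 0) (σ 1) = F 0 1 - F 1 0 := by
  simp [sum_perm_fin_two, Units.smul_def, sub_eq_add_neg]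

lemma sum_sign_smul_perm_fin_three {X : Type*} [AddCommGroup X] (F : Fin 3 → Fin 3 → Fin 3 → X) :
    ∑ σ : Perm (Fin 3), Perm.sign σ • F (σ 0) (σ 1) (σ 2) =
      F 0 1 2 - F 0 2 1 - (F 1 0 2 - F 1 2 0) - (F 2 1 0 - F 2 0 1) := by
  have h : ∀ i, ∑ e : Perm (Fin 2), (fun σ : Perm (Fin 3) => Perm.sign σ • F (σ 0) (σ 1) (σ 2))
      (Perm.decomposeFin.symm (i, e)) = (if i = 0 then (1 : ℤˣ) else -1) •
        (F i (swap 0 i 1) (swap 0 i 2) - F i (swap 0 i 2) (swap 0 i 1)) := by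
    intro i
    refine Eq.trans ?_ (congrArg ((if i = 0 then (1 : ℤˣ) else -1) • ·)
      (sum_sign_smul_perm_fin_two fun a b => F i (swap 0 i a.succ) (swap 0 i b.succ)))
    simp only [Finset.smul_sum, ← mul_smul, ← Perm.decomposeFin.symm_sign,
      ← Perm.decomposeFin_symm_apply_succ]
    refine Finset.sum_congr rfl fun σ _ => ?_
    rw [Perm.decomposeFin_symm_apply_zero]
    rfl
  rw [sum_perm_fin_succ, Finset.sum_congr rfl fun i _ => h i, Fin.sum_univ_three]
  simp [swap_apply_def, Units.smul_def]
  abel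

lemma sum_sign_smul_perm_fin_four {X : Type*} [AddCommGroup X]
    (F : Fin 4 → Fin 4 → Fin 4 → Fin 4 → X) :
    ∑ σ : Perm (Fin 4), Perm.sign σ • F (σ 0) (σ 1) (σ 2) (σ 3) =
      (F 0 1 2 3 - F 0 1 3 2 - (F 0 2 1 3 - F 0 2 3 1) - (F 0 3 2 1 - F 0 3 1 2)) -
      (F 1 0 2 3 - F 1 0 3 2 - (F 1 2 0 3 - F 1 2 3 0) - (F 1 3 2 0 - F 1 3 0 2)) -
      (F 2 1 0 3 - F 2 1 3 0 - (F 2 0 1 3 - F 2 0 3 1) - (F 2 3 0 1 - F 2 3 1 0)) -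
      (F 3 1 2 0 - F 3 1 0 2 - (F 3 2 1 0 - F 3 2 0 1) - (F 3 0 2 1 - F 3 0 1 2)) := by
  have h : ∀ i, ∑ e : Perm (Fin 3),
      (fun σ : Perm (Fin 4) => Perm.sign σ • F (σ 0) (σ 1) (σ 2) (σ 3))
      (Perm.decomposeFin.symm (i, e)) = (if i = 0 then (1 : ℤˣ) else -1) •
        (fun G : Fin 3 → Fin 3 → Fin 3 → X =>
          G 0 1 2 - G 0 2 1 - (G 1 0 2 - G 1 2 0) - (G 2 1 0 - G 2 0 1))
        (fun a b c => F i (swap 0 i a.succ) (swap 0 i b.succ) (swap 0 i c.succ)) := by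
    intro i
    refine Eq.trans ?_ (congrArg ((if i = 0 then (1 : ℤˣ) else -1) • ·)
      (sum_sign_smul_perm_fin_three fun a b c =>
        F i (swap 0 i a.succ) (swap 0 i b.succ) (swap 0 i c.succ)))
    simp only [Finset.smul_sum, ← mul_smul, ← Perm.decomposeFin.symm_sign,
      ← Perm.decomposeFin_symm_apply_succ]
    refine Finset.sum_congr rfl fun σ _ => ?_
    rw [Perm.decomposeFin_symm_apply_zero]
    rfl
  rw [sum_perm_fin_succ, Finset.sum_congr rfl fun i _ => h i, Fin.sum_univ_four]
  simp [swap_apply_def, Units.smul_def]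
  abel

/-- The antisymmetrisation of `b(φ(·, ·), φ(·, ·))` for antisymmetric `φ` and symmetric `b`. -/
lemma sum_sign_smul_pairing {V X : Type*} [AddCommGroup V] [AddCommGroup X] [Module ℝ X]
    (b : V → V → X) (hb : ∀ x y, b x y = b y x) (hneg : ∀ x y, b (-x) y = -b x y)
    (φ : Fin 4 → Fin 4 → V) (hφ : ∀ i j, φ j i = -φ i j) :
    ∑ σ : Perm (Fin 4), Perm.sign σ • b (φ (σ 0) (σ 1)) (φ (σ 2) (σ 3)) =
      (8 : ℝ) • (b (φ 0 1) (φ 2 3) - b (φ 0 2) (φ 1 3) + b (φ 0 3) (φ 1 2)) := by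
  have hneg' : ∀ x y, b x (-y) = -b x y := fun x y => by rw [hb, hneg, hb]
  -- Each splitting into two pairs arises from eight permutations with equal signed terms: a swap
  -- inside a pair changes both the sign and `φ`, and exchanging the pairs is even and leaves `b`
  -- unchanged.
  rw [sum_sign_smul_perm_fin_four fun i j k l => b (φ i j) (φ k l)]
  simp only [hφ 0 1, hφ 0 2, hφ 0 3, hφ 1 2, hφ 1 3, hφ 2 3, hneg, hneg', neg_neg,
    hb (φ 2 3) (φ 0 1), hb (φ 1 3) (φ 0 2), hb (φ 1 2) (φ 0 3)]
  module

lemma polyWedge_two_two {T V W : Type*} [AddCommGroup W] [Module ℝ W]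
    (f : (Fin 2 → V) → W) (κ : (Fin 2 → T) → V) (w : Fin (2 * 2) → T) :
    polyWedge 2 2 f (fun _ => κ) w = (1 / 4 : ℝ) • ∑ σ : Perm (Fin 4),
      Perm.sign σ • f ![κ ![w (σ 0), w (σ 1)], κ ![w (σ 2), w (σ 3)]] := by
  unfold polyWedge
  have h4 : (1 / ((Nat.factorial 2 : ℝ) ^ 2)) = 1 / 4 := by norm_num [Nat.factorial]
  rw [h4]
  congr 1
  refine Finset.sum_congr rfl fun σ _ => ?_
  congr 2
  funext i
  -- The block with index `i` occupies the slots `2i` and `2i + 1`.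
  fin_cases i
  · refine congrArg κ (funext fun j => ?_)
    fin_cases j <;> rfl
  · refine congrArg κ (funext fun j => ?_)
    fin_cases j <;> rfl

lemma polyWedge_one_two {T V W : Type*} [AddCommGroup W] [Module ℝ W]
    (f : (Fin 2 → V) → W) (φ : Fin 2 → (Fin 1 → T) → V) (w : Fin (2 * 1) → T) :
    polyWedge 1 2 f φ w = f ![φ 0 (fun _ => w 0), φ 1 (fun _ => w 1)] -
      f ![φ 0 (fun _ => w 1), φ 1 (fun _ => w 0)] := by
  have h := sum_sign_smul_perm_fin_two
    (fun a b : Fin 2 => f ![φ 0 (fun _ => w a), φ 1 (fun _ => w b)])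
  rw [← h, polyWedge]
  simp only [Nat.factorial_one, Nat.cast_one, one_pow, div_one, one_smul]
  refine Finset.sum_congr rfl fun σ _ => ?_
  congr 2
  funext i
  fin_cases i <;> refine congrArg (φ _) (funext fun j => ?_) <;> fin_cases j <;> rfl

lemma polyWedge_one_three {T V W : Type*} [AddCommGroup W] [Module ℝ W]
    (f : (Fin 3 → V) → W) (φ : (Fin 1 → T) → V) (w : Fin (3 * 1) → T) :
    polyWedge 1 3 f (fun _ => φ) w = ∑ σ : Perm (Fin 3), Perm.sign σ •
      f ![φ fun _ => w (σ 0), φ fun _ => w (σ 1), φ fun _ => w (σ 2)] := by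
  rw [polyWedge]
  simp only [Nat.factorial_one, Nat.cast_one, one_pow, div_one, one_smul]
  refine Finset.sum_congr rfl fun σ _ => ?_
  congr 2
  funext i
  fin_cases i <;> refine congrArg φ (funext fun j => ?_) <;> fin_cases j <;> rfl

end Permutations

/-! ### Integrals over the simplex -/

section Integrals

open MeasureTheory

lemma setIntegral_simplex_one (f : ℝ → ℝ) :
    ∫ t in simplex 1, f (t 0) = ∫ x in (0 : ℝ)..1, f x := by
  have h := (volume_preserving_funUnique (Fin 1) ℝ).setIntegral_preimage_emb
    (MeasurableEquiv.measurableEmbedding _) f (Set.Icc 0 1)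
  have hs : (MeasurableEquiv.funUnique (Fin 1) ℝ) ⁻¹' (Set.Icc 0 1) = simplex 1 := by
    ext t
    simp [simplex, MeasurableEquiv.funUnique]
  rw [intervalIntegral.integral_of_le zero_le_one, ← integral_Icc_eq_integral_Ioc, ← h, hs]
  rfl

lemma setIntegral_simplex_one_sq_sub :
    ∫ t in simplex 1, (t 0 ^ 2 - t 0) = -(1 / 6 : ℝ) := by
  rw [setIntegral_simplex_one fun x => x ^ 2 - x]
  rw [intervalIntegral.integral_sub (by simp) (by simp)]
  norm_num [integral_pow]

lemma volume_real_simplex_two : volume.real (simplex 2) = 1 / 2 := by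
  let s : Set (ℝ × ℝ) := {q | (0 ≤ q.1 ∧ 0 ≤ q.2) ∧ q.1 + q.2 ≤ 1}
  have hs : MeasurableSet s := by
    refine ((isClosed_le continuous_const continuous_fst).inter
      (isClosed_le continuous_const continuous_snd)).inter
      (isClosed_le (continuous_fst.add continuous_snd) continuous_const) |>.measurableSet
  have hpre : (MeasurableEquiv.finTwoArrow : (Fin 2 → ℝ) ≃ᵐ ℝ × ℝ) ⁻¹' s = simplex 2 := by
    ext t
    simp [simplex, s, MeasurableEquiv.finTwoArrow, Fin.forall_fin_two]
  -- The section over `x ∈ [0, 1]` is `[0, 1 - x]`, so Fubini leaves `∫ (1 - x) = 1/2`.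
  have hsec : ∀ x, volume (Prod.mk x ⁻¹' s) =
      (Set.Icc (0 : ℝ) 1).indicator (fun x => ENNReal.ofReal (1 - x)) x := by
    intro x
    by_cases hx : x ∈ Set.Icc (0 : ℝ) 1
    · have : Prod.mk x ⁻¹' s = Set.Icc 0 (1 - x) := by
        ext y
        simp only [s, Set.mem_preimage, Set.mem_ofPred_eq, Set.mem_Icc]
        exact ⟨fun h => ⟨h.1.2, by linarith [h.2]⟩, fun h => ⟨⟨hx.1, h.1⟩, by linarith [h.2]⟩⟩
      rw [this, Real.volume_Icc, Set.indicator_of_mem hx, sub_zero]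
    · have : Prod.mk x ⁻¹' s = ∅ := by
        ext y
        simp only [s, Set.mem_preimage, Set.mem_ofPred_eq, Set.mem_empty_iff_false, iff_false]
        rintro ⟨⟨h1, h2⟩, h3⟩
        exact hx ⟨h1, by linarith⟩
      rw [this, measure_empty, Set.indicator_of_notMem hx]
  rw [← hpre, measureReal_def, (volume_preserving_finTwoArrow ℝ).measure_preimage
    hs.nullMeasurableSet, Measure.volume_eq_prod, Measure.prod_apply hs]
  simp_rw [hsec]
  rw [lintegral_indicator measurableSet_Icc, ← ofReal_integral_eq_lintegral_ofReal]
  · rw [integral_Icc_eq_integral_Ioc, ← intervalIntegral.integral_of_le zero_le_one,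
      intervalIntegral.integral_sub (by simp) (by simp)]
    norm_num
  · exact (continuous_const.sub continuous_id).continuousOn.integrableOn_Icc
  · filter_upwards [ae_restrict_mem measurableSet_Icc] with x hx
    simpa using hx.2

end Integrals

/-! ### Values of the curvature -/

section CurvatureValue

variable {A : Type*} [Ring A] [Algebra ℝ A]

lemma curvatureValue_swap {m : ℕ} (t τ τ' : Fin m → ℝ) (a a' : Fin m → A) :
    curvatureValue t τ' τ a' a = -curvatureValue t τ τ' a a' := by
  rw [curvatureValue, curvatureValue, neg_add, neg_sub, ← Finset.sum_neg_distrib]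
  congr 1
  refine Finset.sum_congr rfl fun j _ => ?_
  module

lemma curvatureValue_zero {m : ℕ} (t τ τ' : Fin m → ℝ) :
    curvatureValue t τ τ' (0 : Fin m → A) 0 = 0 := by
  simp [curvatureValue]

/-- Here `t₀ = 1` is constant, and the vanishing is the Maurer–Cartan equation. -/
lemma curvatureValue_fin_one (t : Fin 0 → ℝ) (v v' : Fin 0 → ℝ) (a a' : Fin 1 → A) :
    curvatureValue (barycentric t) (baryDeriv v) (baryDeriv v') a a' = 0 := by
  simp [curvatureValue, barycentric, baryDeriv]

/-- Only the terms `dtⱼ ∧ aⱼ` survive on a fibre vector, and `∂/∂tᵢ` raises `tᵢ` and lowers `t₀` at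
unit speed. -/
lemma curvatureValue_single {n : ℕ} (t : Fin (n + 1) → ℝ) (i : Fin n) (a : Fin (n + 1) → A) :
    curvatureValue t (baryDeriv (Pi.single i 1)) (baryDeriv 0) 0 a = a i.succ - a 0 := by
  simp [curvatureValue, Fin.sum_univ_succ, baryDeriv, Pi.single_apply, ite_smul, sub_eq_add_neg,
    add_comm]

/-- The coefficient of `aᵢ ∧ aᵢ` is `s² - s` for both `i`, since `(1 - s)² - (1 - s) = s² - s`; the
mixed terms carry `s (1 - s) = -(s² - s)`. -/
lemma curvatureValue_affine (t : Fin 2 → ℝ) (s : ℝ) (h0 : t 0 = 1 - s) (h1 : t 1 = s)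
    (a a' : Fin 2 → A) :
    curvatureValue t 0 0 a a' =
      (s ^ 2 - s) • ((a 1 - a 0) * (a' 1 - a' 0) - (a' 1 - a' 0) * (a 1 - a 0)) := by
  simp only [curvatureValue, Fin.sum_univ_two, h0, h1, Pi.zero_apply, zero_smul, add_mul, mul_add,
    sub_mul, mul_sub, smul_mul_assoc, mul_smul_comm]
  module

lemma curvatureValue_fin_two (t : Fin 1 → ℝ) (a a' : Fin 2 → A) :
    curvatureValue (barycentric t) (baryDeriv 0) (baryDeriv 0) a a' =
      (t 0 ^ 2 - t 0) • ((a 1 - a 0) * (a' 1 - a' 0) - (a' 1 - a' 0) * (a 1 - a 0)) := by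
  have h : baryDeriv (0 : Fin 1 → ℝ) = 0 := by
    funext j
    refine Fin.cases ?_ (fun i => ?_) j <;> simp [baryDeriv]
  rw [h]
  exact curvatureValue_affine _ _ (by simp)
    (Fin.cons_succ (α := fun _ : Fin 2 => ℝ) _ _ 0) a a'

end CurvatureValue

/-! ### Shulman's forms for a quadratic trace form -/

section FibreArguments

variable {E : Type*} [NormedAddCommGroup E]

/-- The arguments `∂/∂t₁, …, ∂/∂t_n, u₀, u₁, …` of Shulman's forms for a quadratic polynomial. -/
def fibreArgs (n : ℕ) (u : Fin (2 * 2 - n) → Fin (n + 1) → E) (i : Fin (2 * 2)) :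
    (Fin n → ℝ) × (Fin (n + 1) → E) :=
  if hi : (i : ℕ) < n then
    ((Pi.single (⟨i, hi⟩ : Fin n) (1 : ℝ) : Fin n → ℝ), (0 : Fin (n + 1) → E))
  else ((0 : Fin n → ℝ), u ⟨(i : ℕ) - n, by have := i.2; omega⟩)

lemma fibreArgs_of_lt {n : ℕ} (u : Fin (2 * 2 - n) → Fin (n + 1) → E) (i : Fin (2 * 2))
    (hi : (i : ℕ) < n) : fibreArgs n u i = (Pi.single ⟨i, hi⟩ 1, 0) := dif_pos hi

lemma fibreArgs_of_le {n : ℕ} (u : Fin (2 * 2 - n) → Fin (n + 1) → E) (i : Fin (2 * 2))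
    (hi : n ≤ (i : ℕ)) :
    fibreArgs n u i = (0, u ⟨(i : ℕ) - n, by have := i.2; omega⟩) := dif_neg (not_lt.2 hi)

end FibreArguments

section LinearForms

variable {E : Type*} [NormedAddCommGroup E] [NormedSpace ℝ E]
  {G : Type*} [TopologicalSpace G] [ChartedSpace E G] [Group G]
  {A : Type*} [NormedRing A] [NormedAlgebra ℝ A]

/-- The curvature at `(t, g)` on two arguments, mapped to the algebra `A`. -/
noncomputable def linCurvature (R : G → A) {n : ℕ} (g : Fin (n + 1) → G) (t : Fin n → ℝ)
    (w w' : (Fin n → ℝ) × (Fin (n + 1) → E)) : A :=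
  curvatureValue (barycentric t) (baryDeriv w.1) (baryDeriv w'.1)
    (fun j => linMaurerCartan R (g j) (w.2 j)) (fun j => linMaurerCartan R (g j) (w'.2 j))

lemma linCurvature_zero_snd (R : G → A) {n : ℕ} (g : Fin (n + 1) → G) (t : Fin n → ℝ)
    (v v' : Fin n → ℝ) :
    linCurvature R g t (v, (0 : Fin (n + 1) → E)) (v', 0) = 0 := by
  simp only [linCurvature, Pi.zero_apply, map_zero]
  exact curvatureValue_zero _ _ _

lemma linCurvature_single (R : G → A) {n : ℕ} (g : Fin (n + 1) → G) (t : Fin n → ℝ)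
    (i : Fin n) (u : Fin (n + 1) → E) :
    linCurvature R g t (Pi.single i 1, 0) (0, u) =
      linMaurerCartan R (g i.succ) (u i.succ) - linMaurerCartan R (g 0) (u 0) := by
  simp only [linCurvature, Pi.zero_apply, map_zero]
  exact curvatureValue_single _ i _

/-- The form `D(ω̄ᵢ)` for `D` the derivative at `1` of `R`. -/
noncomputable def linOmegaBar (R : G → A) {n : ℕ} (i : Fin (n + 1)) (g : Fin (n + 1) → G)
    (u : Fin (n + 1) → E) : A :=
  linMaurerCartan R (g i) (u i) - linMaurerCartan R (g 0) (u 0)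

lemma derivOne_omegaBar (R : G → A) {n : ℕ} (i : Fin (n + 1)) (g : Fin (n + 1) → G)
    (u : Fin (n + 1) → E) :
    derivOne E R (omegaBar E i g u) = linOmegaBar R i g u :=
  map_sub (derivOne E R) _ _

end LinearForms

section TraceForm

variable {A : Type*} [NormedRing A] [NormedAlgebra ℝ A] {𝕜 : Type*} [RCLike 𝕜]
  (tr : A →ₗ[ℝ] 𝕜) (c : 𝕜)

/-- The symmetric bilinear form `c (tr X tr Y - tr (X Y))`. -/
noncomputable def traceForm₂ (X Y : A) : 𝕜 := c * (tr X * tr Y - tr (X * Y))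

variable {tr}

lemma traceForm₂_comm (htr : ∀ X Y, tr (X * Y) = tr (Y * X)) (X Y : A) :
    traceForm₂ tr c X Y = traceForm₂ tr c Y X := by
  rw [traceForm₂, traceForm₂, htr, mul_comm (tr X)]

lemma traceForm₂_neg_left (X Y : A) : traceForm₂ tr c (-X) Y = -traceForm₂ tr c X Y := by
  simp only [traceForm₂, map_neg, neg_mul]
  ring

lemma traceForm₂_zero_left (Y : A) : traceForm₂ tr c 0 Y = 0 := by
  simp [traceForm₂]

lemma traceForm₂_smul_right (r : ℝ) (X Y : A) :
    traceForm₂ tr c X (r • Y) = r • traceForm₂ tr c X Y := by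
  simp only [traceForm₂, map_smul, mul_smul_comm, ← smul_sub]

end TraceForm

section ShulmanForms

open MeasureTheory

variable {E : Type*} [NormedAddCommGroup E] [NormedSpace ℝ E] [CompleteSpace E]
  {G : Type*} [TopologicalSpace G] [ChartedSpace E G] [Group G] [LieGroup 𝓘(ℝ, E) ∞ G]
  {A : Type*} [NormedRing A] [NormedAlgebra ℝ A] {𝕜 : Type*} [RCLike 𝕜] {tr : A →ₗ[ℝ] 𝕜} (c : 𝕜)
  {R : G →* A} (hR : ContMDiff 𝓘(ℝ, E) 𝓘(ℝ, A) ∞ R)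
  {P : A →L[ℝ] E} (hP : ∀ e, P (derivOne E R e) = e) (htr : ∀ X Y, tr (X * Y) = tr (Y * X))
  {p : MultilinearMap ℝ (fun _ : Fin 2 => GroupLieAlgebra 𝓘(ℝ, E) G) 𝕜}
  (hp : ∀ X Y : E, p ![X, Y] = traceForm₂ tr c (derivOne E R X) (derivOne E R Y))

include hR hP htr hp in
lemma polyWedge_curvature {n : ℕ} (g : Fin (n + 1) → G) (t : Fin n → ℝ)
    (w : Fin (2 * 2) → (Fin n → ℝ) × (Fin (n + 1) → E)) :
    polyWedge 2 2 p (fun _ => curvature E n (t, g)) w =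
      (2 : ℝ) • (traceForm₂ tr c (linCurvature R g t (w 0) (w 1)) (linCurvature R g t (w 2) (w 3)) -
        traceForm₂ tr c (linCurvature R g t (w 0) (w 2)) (linCurvature R g t (w 1) (w 3)) +
        traceForm₂ tr c (linCurvature R g t (w 0) (w 3)) (linCurvature R g t (w 1) (w 2))) := by
  have h := sum_sign_smul_pairing (traceForm₂ tr c) (traceForm₂_comm c htr)
    (traceForm₂_neg_left c) (fun i j : Fin 4 => linCurvature R g t (w i) (w j))
    (fun i j => curvatureValue_swap _ _ _ _ _)
  refine (polyWedge_two_two _ _ w).trans ?_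
  have hK : ∀ i j, derivOne E R (curvature E n (t, g) ![w i, w j]) =
      linCurvature R g t (w i) (w j) := fun i j =>
    derivOne_curvature R hR P hP n (t, g) ![w i, w j]
  have h' : ∀ i j k l, p ![curvature E n (t, g) ![w i, w j], curvature E n (t, g) ![w k, w l]] =
      traceForm₂ tr c (linCurvature R g t (w i) (w j)) (linCurvature R g t (w k) (w l)) := by
    intro i j k l
    rw [← hK, ← hK]
    exact hp _ _
  refine (congrArg ((1 / 4 : ℝ) • ·) ((Finset.sum_congr rfl fun σ _ => congrArg _
    (h' (σ 0) (σ 1) (σ 2) (σ 3))).trans h)).trans ?_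
  -- The factor `2` is `8 / 4`: eight permutations per pairing, over `(2!)²`.
  rw [smul_smul]
  norm_num

include hR hP htr hp in
lemma shulmanForm_eq_integral {n : ℕ} (hn : n ≤ 2 * 2) (g : Fin (n + 1) → G)
    (u : Fin (2 * 2 - n) → Fin (n + 1) → E) {w : Fin (2 * 2) → (Fin n → ℝ) × (Fin (n + 1) → E)}
    (hw : w = fibreArgs n u) :
    shulmanForm E p n g u = ∫ t in simplex n,
      (2 : ℝ) • (traceForm₂ tr c (linCurvature R g t (w 0) (w 1)) (linCurvature R g t (w 2) (w 3)) -
        traceForm₂ tr c (linCurvature R g t (w 0) (w 2)) (linCurvature R g t (w 1) (w 3)) +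
        traceForm₂ tr c (linCurvature R g t (w 0) (w 3)) (linCurvature R g t (w 1) (w 2))) := by
  subst hw
  refine (if_pos hn).trans ?_
  refine congrArg (fun f : (Fin n → ℝ) → 𝕜 => ∫ t in simplex n, f t) (funext fun t => ?_)
  exact polyWedge_curvature c hR hP htr hp g t _

include hR hP htr hp in
lemma shulmanForm_zero (g : Fin 1 → G) (u : Fin 4 → Fin 1 → E) : shulmanForm E p 0 g u = 0 := by
  rw [shulmanForm_eq_integral c hR hP htr hp (by norm_num) g u rfl]
  have h : ∀ (t : Fin 0 → ℝ) (w w' : (Fin 0 → ℝ) × (Fin 1 → E)), linCurvature R g t w w' = 0 :=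
    fun t w w' => curvatureValue_fin_one t _ _ _ _
  simp [h, traceForm₂_zero_left]

-- Slots `0`, `1`, `2` hold fibre vectors, and every splitting of four slots into pairs puts two of
-- them together, where the curvature vanishes.
include hR hP htr hp in
lemma shulmanForm_of_two_lt {n : ℕ} (hn : 2 < n) (g : Fin (n + 1) → G)
    (u : Fin (2 * 2 - n) → Fin (n + 1) → E) : shulmanForm E p n g u = 0 := by
  by_cases hn4 : n ≤ 2 * 2
  · rw [shulmanForm_eq_integral c hR hP htr hp hn4 g u rfl]
    have h0 := fibreArgs_of_lt u 0 (by simp; omega)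
    have h1 := fibreArgs_of_lt u 1 (by simp; omega)
    have h2 := fibreArgs_of_lt u 2 (by simpa using hn)
    simp [h0, h1, h2, linCurvature_zero_snd, traceForm₂_comm c htr _ 0, traceForm₂_zero_left]
  · exact if_neg hn4

-- The fibre vector turns one curvature factor into `ω̄₁`; the other is `(t² - t)` times a
-- commutator. Commutators are traceless, so only `-tr (X Y)` contributes, and the three pairings
-- expand into the six permutations. The constant is `2 · (-1/6) · (-1) = 1/3`.
include hR hP htr hp in
lemma shulmanForm_one (g : Fin 2 → G) (u : Fin 3 → Fin 2 → E) :
    shulmanForm E p 1 g u = (1 / 3 : ℝ) • (c * ∑ σ : Equiv.Perm (Fin 3), Equiv.Perm.sign σ •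
      tr (linOmegaBar R 1 g (u (σ 0)) * linOmegaBar R 1 g (u (σ 1)) *
        linOmegaBar R 1 g (u (σ 2)))) := by
  rw [shulmanForm_eq_integral c hR hP htr hp (by norm_num) g u rfl]
  have h0 : fibreArgs 1 u 0 = (Pi.single 0 1, 0) := fibreArgs_of_lt u 0 (by simp)
  have h1 : fibreArgs 1 u 1 = (0, u 0) := fibreArgs_of_le (n := 1) u 1 (by decide)
  have h2 : fibreArgs 1 u 2 = (0, u 1) := fibreArgs_of_le (n := 1) u 2 (by decide)
  have h3 : fibreArgs 1 u 3 = (0, u 2) := fibreArgs_of_le (n := 1) u 3 (by decide)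
  set b : Fin 3 → A := fun i => linOmegaBar R 1 g (u i) with hb
  have hs : ∀ (t : Fin 1 → ℝ) i, linCurvature R g t (Pi.single 0 1, 0) (0, u i) = b i :=
    fun t i => linCurvature_single R g t 0 (u i)
  have hc : ∀ (t : Fin 1 → ℝ) i j, linCurvature R g t (0, u i) (0, u j) =
      (t 0 ^ 2 - t 0) • (b i * b j - b j * b i) :=
    fun t i j => curvatureValue_fin_two t _ _
  simp only [h0, h1, h2, h3, hs, hc, traceForm₂_smul_right, ← smul_sub, ← smul_add]
  simp_rw [smul_comm (2 : ℝ)]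
  rw [integral_smul_const, setIntegral_simplex_one_sq_sub,
    sum_sign_smul_perm_fin_three fun i j k => tr (b i * b j * b k)]
  simp only [traceForm₂, map_sub, mul_sub, ← mul_assoc, smul_smul]
  -- This makes the traces of the commutators cancel.
  rw [htr (b 0) (b 1), htr (b 0) (b 2), htr (b 1) (b 2)]
  simp only [Algebra.smul_def]
  push_cast
  ring

-- The pairing that joins the two fibre vectors vanishes; the other two do not depend on `t`, and
-- the area `1/2` cancels the factor `2`. The result is minus the wedge of `ω̄₁` and `ω̄₂` under the
-- trace form.
include hR hP htr hp in
lemma shulmanForm_two (g : Fin 3 → G) (u : Fin 2 → Fin 3 → E) :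
    shulmanForm E p 2 g u =
      traceForm₂ tr c (linOmegaBar R 1 g (u 1)) (linOmegaBar R 2 g (u 0)) -
      traceForm₂ tr c (linOmegaBar R 1 g (u 0)) (linOmegaBar R 2 g (u 1)) := by
  rw [shulmanForm_eq_integral c hR hP htr hp (by norm_num) g u rfl]
  have h0 : fibreArgs 2 u 0 = (Pi.single 0 1, 0) := fibreArgs_of_lt u 0 (by simp)
  have h1 : fibreArgs 2 u 1 = (Pi.single 1 1, 0) := fibreArgs_of_lt u 1 (by simp)
  have h2 : fibreArgs 2 u 2 = (0, u 0) := fibreArgs_of_le (n := 2) u 2 (by decide)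
  have h3 : fibreArgs 2 u 3 = (0, u 1) := fibreArgs_of_le (n := 2) u 3 (by decide)
  have hs0 : ∀ (t : Fin 2 → ℝ) i, linCurvature R g t (Pi.single 0 1, 0) (0, u i) =
      linOmegaBar R 1 g (u i) := fun t i => linCurvature_single R g t 0 (u i)
  have hs1 : ∀ (t : Fin 2 → ℝ) i, linCurvature R g t (Pi.single 1 1, 0) (0, u i) =
      linOmegaBar R 2 g (u i) := fun t i => linCurvature_single R g t 1 (u i)
  simp only [h0, h1, h2, h3, hs0, hs1, linCurvature_zero_snd, traceForm₂_zero_left]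
  rw [setIntegral_const, volume_real_simplex_two, smul_smul]
  norm_num
  ring

end ShulmanForms

/-! ### The second coefficient of the characteristic polynomial -/

section Charpoly

open Finset

lemma det_submatrix_pair {N : ℕ} {K : Type*} [CommRing K] (M : Matrix (Fin N) (Fin N) K)
    {i j : Fin N} (hij : i ≠ j) :
    (M.submatrix (Subtype.val : ({i, j} : Finset (Fin N)) → Fin N) Subtype.val).det =
      M i i * M j j - M i j * M j i := by
  let e : Fin 2 → ({i, j} : Finset (Fin N)) := ![⟨i, by simp⟩, ⟨j, by simp⟩]
  have he : Function.Bijective e := by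
    rw [Fintype.bijective_iff_injective_and_card]
    refine ⟨?_, by rw [Fintype.card_coe, Finset.card_pair hij, Fintype.card_fin]⟩
    intro a b hab
    fin_cases a <;> fin_cases b <;> simp_all [e, hij.symm]
  rw [← Matrix.det_submatrix_equiv_self (Equiv.ofBijective e he), Matrix.det_fin_two]
  simp [e]

/-- The coefficient is the sum of the principal `2 × 2` minors over two-element subsets. Expanding
the right-hand side gives the same minors summed over ordered pairs: equal indices contribute `0`,
and each subset is counted twice. -/
lemma two_mul_charpoly_coeff {N : ℕ} {K : Type*} [Field K] [CharZero K]
    (M : Matrix (Fin N) (Fin N) K) (hN : 2 ≤ N) :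
    2 * M.charpoly.coeff (N - 2) = M.trace * M.trace - (M * M).trace := by
  have h := Matrix.charpoly_coeff_eq_sum_minors M 2 (by simpa using hN)
  rw [Fintype.card_fin] at h
  rw [h, neg_one_sq, one_mul]
  have h2 : M.trace * M.trace - (M * M).trace =
      ∑ q : Fin N × Fin N, (M q.1 q.1 * M q.2 q.2 - M q.1 q.2 * M q.2 q.1) := by
    rw [Finset.sum_sub_distrib, Fintype.sum_prod_type, Fintype.sum_prod_type]
    simp only [Matrix.trace, Matrix.diag, Matrix.mul_apply, Finset.sum_mul_sum]
  have h3 : ∑ q : Fin N × Fin N, (M q.1 q.1 * M q.2 q.2 - M q.1 q.2 * M q.2 q.1) =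
      ∑ q ∈ (univ : Finset (Fin N)).offDiag, (M q.1 q.1 * M q.2 q.2 - M q.1 q.2 * M q.2 q.1) := by
    symm
    refine Finset.sum_subset (Finset.subset_univ _) fun q _ hq => ?_
    have : q.1 = q.2 := by simpa using hq
    rw [this, sub_self]
  have h4 : ∀ q ∈ (univ : Finset (Fin N)).offDiag,
      ({q.1, q.2} : Finset (Fin N)) ∈ univ.powersetCard 2 := by
    intro q hq
    rw [Finset.mem_powersetCard]
    exact ⟨Finset.subset_univ _, Finset.card_pair (by simpa using hq)⟩
  rw [h2, h3, ← Finset.sum_fiberwise_of_maps_to h4, Finset.mul_sum]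
  refine Finset.sum_congr rfl fun s hs => ?_
  obtain ⟨i, j, hij, rfl⟩ := Finset.card_eq_two.1 (Finset.mem_powersetCard.1 hs).2
  have h5 : ((univ : Finset (Fin N)).offDiag.filter
      fun q => ({q.1, q.2} : Finset (Fin N)) = {i, j}) = {(i, j), (j, i)} := by
    ext ⟨a, b⟩
    simp only [Finset.mem_filter, Finset.mem_offDiag, Finset.mem_univ, true_and,
      Finset.mem_insert, Finset.mem_singleton, Prod.mk.injEq]
    constructor
    · rintro ⟨hab, h⟩
      have ha : a ∈ ({i, j} : Finset (Fin N)) := h ▸ Finset.mem_insert_self a _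
      have hb : b ∈ ({i, j} : Finset (Fin N)) := h ▸ (by simp)
      simp only [Finset.mem_insert, Finset.mem_singleton] at ha hb
      grind
    · rintro (⟨rfl, rfl⟩ | ⟨rfl, rfl⟩)
      · exact ⟨hij, rfl⟩
      · exact ⟨hij.symm, Finset.pair_comm _ _⟩
  rw [h5, Finset.sum_pair (by simp [hij]), det_submatrix_pair M hij]
  ring

lemma trace_mul_trace_sub_eq_zero_of_lt_two {N : ℕ} {K : Type*} [CommRing K]
    (M : Matrix (Fin N) (Fin N) K) (hN : N < 2) : M.trace * M.trace - (M * M).trace = 0 := by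
  interval_cases N
  · simp [Matrix.trace]
  · simp [Matrix.trace, Matrix.mul_apply]

end Charpoly

/-! ### The first Pontryagin polynomial -/

section Pontryagin

variable {E : Type*} [NormedAddCommGroup E] [NormedSpace ℝ E]
  {G : Type*} [TopologicalSpace G] [ChartedSpace E G] [Group G]
  {𝕜 : Type*} [RCLike 𝕜] {N : ℕ}

variable (E) in
/-- `toMatrix` as a real linear map. -/
noncomputable def toMatrixLin (ρ : G →* GL (Fin N) 𝕜) :
    GroupLieAlgebra 𝓘(ℝ, E) G →ₗ[ℝ] Matrix (Fin N) (Fin N) 𝕜 where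
  toFun := toMatrix E ρ
  map_add' X Y := by
    ext i j
    exact map_add (mfderiv 𝓘(ℝ, E) 𝓘(ℝ, 𝕜)
      (fun g : G => (ρ g : Matrix (Fin N) (Fin N) 𝕜) i j) 1) X Y
  map_smul' r X := by
    ext i j
    exact map_smul (mfderiv 𝓘(ℝ, E) 𝓘(ℝ, 𝕜)
      (fun g : G => (ρ g : Matrix (Fin N) (Fin N) 𝕜) i j) 1) r X

/-- A bilinear map as a multilinear map in two variables. -/
noncomputable def multilinearOfBilin {V W : Type*} [AddCommGroup V] [Module ℝ V] [AddCommGroup W]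
    [Module ℝ W] (b : V →ₗ[ℝ] V →ₗ[ℝ] W) : MultilinearMap ℝ (fun _ : Fin 2 => V) W where
  toFun v := b (v 0) (v 1)
  map_update_add' {hd} v i x y := by
    cases Subsingleton.elim hd (instDecidableEqFin 2)
    fin_cases i <;> simp
  map_update_smul' {hd} v i r x := by
    cases Subsingleton.elim hd (instDecidableEqFin 2)
    fin_cases i <;> simp

variable (𝕜 N) in
/-- The bilinear form `(tr X tr Y - tr (X Y)) / (8 π²)` on matrices. -/
noncomputable def pontryaginBilin :
    Matrix (Fin N) (Fin N) 𝕜 →ₗ[ℝ] Matrix (Fin N) (Fin N) 𝕜 →ₗ[ℝ] 𝕜 :=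
  LinearMap.mk₂ ℝ (fun X Y => ((1 / (8 * Real.pi ^ 2) : ℝ) : 𝕜) *
      (X.trace * Y.trace - (X * Y).trace))
    (fun X X' Y => by simp only [Matrix.trace_add, add_mul]; ring)
    (fun r X Y => by
      simp only [Matrix.trace_smul, smul_mul_assoc, mul_smul_comm, ← smul_sub])
    (fun X Y Y' => by simp only [Matrix.trace_add, mul_add]; ring)
    (fun r X Y => by
      simp only [Matrix.trace_smul, mul_smul_comm, ← smul_sub])

variable (E) in
/-- The first Pontryagin polynomial. -/
noncomputable def pontryagin (ρ : G →* GL (Fin N) 𝕜) :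
    MultilinearMap ℝ (fun _ : Fin 2 => GroupLieAlgebra 𝓘(ℝ, E) G) 𝕜 :=
  multilinearOfBilin ((pontryaginBilin 𝕜 N).compl₁₂ (toMatrixLin E ρ) (toMatrixLin E ρ))

lemma pontryagin_apply (ρ : G →* GL (Fin N) 𝕜) (v : Fin 2 → GroupLieAlgebra 𝓘(ℝ, E) G) :
    pontryagin E ρ v = ((1 / (8 * Real.pi ^ 2) : ℝ) : 𝕜) *
      ((toMatrix E ρ (v 0)).trace * (toMatrix E ρ (v 1)).trace -
        (toMatrix E ρ (v 0) * toMatrix E ρ (v 1)).trace) := rfl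

/-- Two symmetric bilinear maps with the same diagonal values agree. -/
lemma multilinearMap_eq_of_diagonal {V W : Type*} [AddCommGroup V] [Module ℝ V]
    [AddCommGroup W] [Module ℝ W] {p q : MultilinearMap ℝ (fun _ : Fin 2 => V) W}
    (hp : ∀ x y, p ![x, y] = p ![y, x]) (hq : ∀ x y, q ![x, y] = q ![y, x])
    (h : ∀ x, p ![x, x] = q ![x, x]) : p = q := by
  have expand : ∀ (r : MultilinearMap ℝ (fun _ : Fin 2 => V) W), (∀ x y, r ![x, y] = r ![y, x]) →
      ∀ x y, r ![x + y, x + y] = r ![x, x] + (2 : ℝ) • r ![x, y] + r ![y, y] := by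
    intro r hr x y
    have h1 : ∀ a b c, r ![a + b, c] = r ![a, c] + r ![b, c] := fun a b c =>
      r.cons_add (n := 1) ![c] a b
    have h2 : ∀ a b c, r ![a, b + c] = r ![a, b] + r ![a, c] := fun a b c => by
      rw [hr, h1, hr b, hr c]
    rw [h1, h2, h2, hr y x]
    module
  ext v
  have hv : v = ![v 0, v 1] := by
    funext i
    fin_cases i <;> rfl
  rw [hv]
  have e := h (v 0 + v 1)
  rw [expand p hp, expand q hq, h, h] at e
  have e2 : (2 : ℝ) • p ![v 0, v 1] = (2 : ℝ) • q ![v 0, v 1] := by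
    simpa using e
  exact smul_right_injective W (two_ne_zero (α := ℝ)) e2

/-! ### Matrices as a normed algebra, and `ρ` as a smooth map into it -/

variable (𝕜 N) in
/-- The algebra of `N × N` matrices with the `ℓ^∞` operator norm. -/
def MatrixAlgebra : Type _ := Matrix (Fin N) (Fin N) 𝕜

noncomputable instance : NormedRing (MatrixAlgebra 𝕜 N) := Matrix.linftyOpNormedRing

noncomputable instance : NormedAlgebra ℝ (MatrixAlgebra 𝕜 N) := Matrix.linftyOpNormedAlgebra

variable (𝕜 N) in
/-- The identity map from matrices to the normed algebra of matrices. -/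
noncomputable def toMatrixAlgebra : (Fin N → Fin N → 𝕜) ≃ₗ[ℝ] MatrixAlgebra 𝕜 N where
  toFun M := M
  invFun M := M
  map_add' _ _ := rfl
  map_smul' _ _ := rfl
  left_inv _ := rfl
  right_inv _ := rfl

instance : FiniteDimensional ℝ (MatrixAlgebra 𝕜 N) :=
  (toMatrixAlgebra 𝕜 N).finiteDimensional

variable (𝕜 N) in
/-- The trace on the normed algebra of matrices. -/
noncomputable def matrixAlgebraTrace : MatrixAlgebra 𝕜 N →ₗ[ℝ] 𝕜 :=
  Matrix.traceLinearMap (Fin N) ℝ 𝕜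

/-- A homomorphism to `GL(N)`, as a homomorphism to the normed algebra of matrices. -/
noncomputable def matrixHom (ρ : G →* GL (Fin N) 𝕜) : G →* MatrixAlgebra 𝕜 N where
  toFun g := (ρ g : Matrix (Fin N) (Fin N) 𝕜)
  map_one' := by rw [map_one]; rfl
  map_mul' g h := by rw [map_mul]; rfl

lemma contMDiff_matrixHom {ρ : G →* GL (Fin N) 𝕜} (hρ : IsSmoothImmersion E ρ) :
    ContMDiff 𝓘(ℝ, E) 𝓘(ℝ, MatrixAlgebra 𝕜 N) ∞ (matrixHom ρ) := by
  have h : ContMDiff 𝓘(ℝ, E) 𝓘(ℝ, Fin N → Fin N → 𝕜) ∞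
      (fun g : G => fun i j => (ρ g : Matrix (Fin N) (Fin N) 𝕜) i j) :=
    contMDiff_pi_space.2 fun i => contMDiff_pi_space.2 fun j => hρ.1 i j
  exact (LinearMap.toContinuousLinearMap (toMatrixAlgebra 𝕜 N).toLinearMap).contMDiff.comp h

lemma derivOne_matrixHom {ρ : G →* GL (Fin N) 𝕜} (hρ : IsSmoothImmersion E ρ) (X : E) :
    derivOne E (matrixHom ρ) X = toMatrix E ρ X := by
  refine Matrix.ext fun i j => ?_
  let L : MatrixAlgebra 𝕜 N →L[ℝ] 𝕜 := LinearMap.toContinuousLinearMap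
    ((LinearMap.proj j ∘ₗ LinearMap.proj i) ∘ₗ (toMatrixAlgebra 𝕜 N).symm.toLinearMap)
  have h1 : HasMFDerivAt 𝓘(ℝ, MatrixAlgebra 𝕜 N) 𝓘(ℝ, 𝕜) L (matrixHom ρ (1 : G)) L :=
    L.hasFDerivAt.hasMFDerivAt
  have h2 := ((contMDiff_matrixHom hρ).mdifferentiableAt (x := 1) (by simp)).hasMFDerivAt
  have h3 := (h1.comp (1 : G) h2).mfderiv
  exact (congrArg (fun T : E →L[ℝ] 𝕜 => T X) h3).symm

/-- The immersion condition at `1` makes the derivative injective, and linear maps out of the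
finite-dimensional matrix algebra are continuous. -/
lemma exists_leftInverse_derivOne_matrixHom {ρ : G →* GL (Fin N) 𝕜} (hρ : IsSmoothImmersion E ρ) :
    ∃ P : MatrixAlgebra 𝕜 N →L[ℝ] E, ∀ X, P (derivOne E (matrixHom ρ) X) = X := by
  have hinj : LinearMap.ker (derivOne E (matrixHom ρ)).toLinearMap = ⊥ := by
    refine LinearMap.ker_eq_bot'.2 fun X hX => ?_
    refine hρ.2 1 X fun i j => ?_
    have h := (derivOne_matrixHom hρ X).symm.trans hX
    exact congrFun (congrFun h i) j
  obtain ⟨P, hP⟩ := LinearMap.exists_leftInverse_of_injective _ hinj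
  exact ⟨LinearMap.toContinuousLinearMap P, fun X => congrArg (fun T => T X) hP⟩

open scoped Matrix in
/-- The Lie algebra of a group of unitary matrices consists of skew-Hermitian matrices. -/
lemma conjTranspose_toMatrix {ρ : G →* GL (Fin N) 𝕜} (hρ : IsSmoothImmersion E ρ)
    (hu : ∀ g : G, (ρ g : Matrix (Fin N) (Fin N) 𝕜) ∈ Matrix.unitaryGroup (Fin N) 𝕜)
    (X : GroupLieAlgebra 𝓘(ℝ, E) G) : (toMatrix E ρ X)ᴴ = -toMatrix E ρ X := by
  let C : MatrixAlgebra 𝕜 N →L[ℝ] MatrixAlgebra 𝕜 N := LinearMap.toContinuousLinearMap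
    { toFun := fun M => Matrix.conjTranspose M
      map_add' := fun M M' => Matrix.conjTranspose_add M M'
      map_smul' := fun r M => by
        refine Matrix.ext fun i j => ?_
        exact (star_smul r (M j i)).trans (by simp; rfl) }
  have hd := (contMDiff_matrixHom hρ).mdifferentiableAt (x := (1 : G)) (by simp)
  have h1 : HasMFDerivAt 𝓘(ℝ, MatrixAlgebra 𝕜 N) 𝓘(ℝ, MatrixAlgebra 𝕜 N) C
      (matrixHom ρ (1 : G)) C := C.hasFDerivAt.hasMFDerivAt
  have h2 := h1.comp (1 : G) hd.hasMFDerivAt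
  -- For unitary matrices the conjugate transpose is the inverse, whose derivative at `1` is `-dρ`.
  have h3 := vecDeriv_of_mul_eq_one (S := fun g => C (matrixHom ρ g)) (F := matrixHom ρ)
    (x := (1 : G)) h2.mdifferentiableAt hd
    (fun g => Matrix.mem_unitaryGroup_iff'.1 (hu g)) (fun g => Matrix.mem_unitaryGroup_iff.1 (hu g)) X
  have h4 : vecDeriv 𝓘(ℝ, E) (fun g => C (matrixHom ρ g)) (1 : G) X =
      C (derivOne E (matrixHom ρ) X) := congrArg (fun T : E →L[ℝ] _ => T X) h2.mfderiv
  have h5 : C (matrixHom ρ (1 : G)) = 1 := by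
    rw [map_one]
    exact Matrix.conjTranspose_one
  rw [h4] at h3
  simp only [h5, one_mul, mul_one] at h3
  have h6 := derivOne_matrixHom hρ X
  change C (derivOne E (matrixHom ρ) X) = -derivOne E (matrixHom ρ) X at h3
  rw [h6] at h3
  exact h3

/-- For skew-Hermitian `X`, `Y`, conjugation negates both traces and takes `tr (X Y)` to `tr (Y X)`,
so the value is its own conjugate. -/
lemma im_pontryagin_eq_zero {ρ : G →* GL (Fin N) 𝕜} (hρ : IsSmoothImmersion E ρ)
    (hu : ∀ g : G, (ρ g : Matrix (Fin N) (Fin N) 𝕜) ∈ Matrix.unitaryGroup (Fin N) 𝕜)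
    (v : Fin 2 → GroupLieAlgebra 𝓘(ℝ, E) G) : RCLike.im (pontryagin E ρ v) = 0 := by
  rw [← RCLike.conj_eq_iff_im, pontryagin_apply]
  have h := conjTranspose_toMatrix hρ hu
  have ht : ∀ X, (starRingEnd 𝕜) (toMatrix E ρ X).trace = -(toMatrix E ρ X).trace := fun X => by
    rw [starRingEnd_apply, ← Matrix.trace_conjTranspose, h, Matrix.trace_neg]
  rw [map_mul, map_sub, map_mul, ht, ht, RCLike.conj_ofReal, starRingEnd_apply (Matrix.trace _),
    ← Matrix.trace_conjTranspose, Matrix.conjTranspose_mul, h, h, neg_mul_neg, neg_mul_neg,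
    Matrix.trace_mul_comm]

/-! ### Invariance, existence and uniqueness of the first Pontryagin polynomial -/

section LieGroup

variable [LieGroup 𝓘(ℝ, E) ∞ G]

lemma toMatrix_adjoint {ρ : G →* GL (Fin N) 𝕜} (hρ : IsSmoothImmersion E ρ) (g : G)
    (X : GroupLieAlgebra 𝓘(ℝ, E) G) :
    toMatrix E ρ (adjoint E g X) = (ρ g : Matrix (Fin N) (Fin N) 𝕜) * toMatrix E ρ X *
      (ρ g⁻¹ : Matrix (Fin N) (Fin N) 𝕜) := by
  have h := derivOne_adjoint (matrixHom ρ) (contMDiff_matrixHom hρ) g X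
  have h1 := derivOne_matrixHom hρ (adjoint E g X)
  have h2 := derivOne_matrixHom hρ X
  rw [h2] at h
  exact h1.symm.trans h

lemma isPontryaginPolynomial_pontryagin {ρ : G →* GL (Fin N) 𝕜} (hρ : IsSmoothImmersion E ρ) :
    IsPontryaginPolynomial E ρ (pontryagin E ρ) := by
  refine ⟨⟨fun σ v => ?_, fun g v => ?_⟩, fun X => ?_⟩
  · rw [pontryagin_apply, pontryagin_apply]
    have h : (σ 0 = 0 ∧ σ 1 = 1) ∨ (σ 0 = 1 ∧ σ 1 = 0) := by
      revert σ; decide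
    rcases h with ⟨h0, h1⟩ | ⟨h0, h1⟩
    · rw [h0, h1]
    · rw [h0, h1, Matrix.trace_mul_comm, mul_comm (Matrix.trace _) (Matrix.trace _)]
  · have hinv : (ρ g⁻¹ : Matrix (Fin N) (Fin N) 𝕜) * (ρ g : Matrix (Fin N) (Fin N) 𝕜) = 1 := by
      rw [← Units.val_mul, ← map_mul, inv_mul_cancel, map_one, Units.val_one]
    rw [pontryagin_apply, pontryagin_apply, toMatrix_adjoint hρ, toMatrix_adjoint hρ]
    have hconj : ∀ X : Matrix (Fin N) (Fin N) 𝕜,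
        ((ρ g : Matrix (Fin N) (Fin N) 𝕜) * X * (ρ g⁻¹ : Matrix (Fin N) (Fin N) 𝕜)).trace =
          X.trace := fun X => by
      rw [Matrix.trace_mul_comm, ← mul_assoc, hinv, one_mul]
    have hmul : ∀ X Y : Matrix (Fin N) (Fin N) 𝕜,
        ((ρ g : Matrix (Fin N) (Fin N) 𝕜) * X * (ρ g⁻¹ : Matrix (Fin N) (Fin N) 𝕜)) *
          ((ρ g : Matrix (Fin N) (Fin N) 𝕜) * Y * (ρ g⁻¹ : Matrix (Fin N) (Fin N) 𝕜)) =
        (ρ g : Matrix (Fin N) (Fin N) 𝕜) * (X * Y) * (ρ g⁻¹ : Matrix (Fin N) (Fin N) 𝕜) := by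
      intro X Y
      have h (a : Matrix (Fin N) (Fin N) 𝕜) :
          (ρ g⁻¹ : Matrix (Fin N) (Fin N) 𝕜) * ((ρ g : Matrix (Fin N) (Fin N) 𝕜) * a) = a := by
        rw [← mul_assoc, hinv, one_mul]
      simp only [mul_assoc, h]
    rw [hmul, hconj, hconj, hconj]
  · rw [pontryagin_apply]
    set M := toMatrix E ρ X with hM
    split_ifs with hN
    · have h := two_mul_charpoly_coeff (((1 / (2 * Real.pi) : ℝ) : 𝕜) • M) hN
      have e : (Matrix.charpoly (((1 / (2 * Real.pi) : ℝ) : 𝕜) • M)).coeff (N - 2) =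
          2⁻¹ * (2 * (Matrix.charpoly (((1 / (2 * Real.pi) : ℝ) : 𝕜) • M)).coeff (N - 2)) := by
        rw [inv_mul_cancel_left₀ two_ne_zero]
      -- One half from the sum over minors, and `1 / (2π)` from each factor of the scaled matrix.
      have hc : ((1 / (8 * Real.pi ^ 2) : ℝ) : 𝕜) =
          2⁻¹ * (((1 / (2 * Real.pi) : ℝ) : 𝕜) * ((1 / (2 * Real.pi) : ℝ) : 𝕜)) := by
        have h2 : (2⁻¹ : 𝕜) = ((2⁻¹ : ℝ) : 𝕜) := by push_cast; rfl
        rw [h2, ← RCLike.ofReal_mul, ← RCLike.ofReal_mul]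
        congr 1
        have := Real.pi_ne_zero
        field_simp
        norm_num
      rw [e, h, hc]
      simp only [Matrix.trace_smul, smul_mul_assoc, mul_smul_comm, smul_eq_mul]
      ring
    · rw [trace_mul_trace_sub_eq_zero_of_lt_two M (not_le.1 hN), mul_zero]

lemma eq_pontryagin_of_isPontryaginPolynomial {ρ : G →* GL (Fin N) 𝕜}
    (hρ : IsSmoothImmersion E ρ)
    {q : MultilinearMap ℝ (fun _ : Fin 2 => GroupLieAlgebra 𝓘(ℝ, E) G) 𝕜}
    (hq : IsPontryaginPolynomial E ρ q) : q = pontryagin E ρ := by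
  have hp := isPontryaginPolynomial_pontryagin hρ
  have hconst : ∀ X : GroupLieAlgebra 𝓘(ℝ, E) G, (![X, X] : Fin 2 → _) = fun _ => X := fun X => by
    funext i; fin_cases i <;> rfl
  have hswap : ∀ X Y : GroupLieAlgebra 𝓘(ℝ, E) G,
      (fun i => (![X, Y] : Fin 2 → GroupLieAlgebra 𝓘(ℝ, E) G) (Equiv.swap 0 1 i)) = ![Y, X] :=
    fun X Y => by funext i; fin_cases i <;> rfl
  refine multilinearMap_eq_of_diagonal (fun X Y => ?_) (fun X Y => ?_) fun X => ?_
  · rw [← hq.1.1 (Equiv.swap 0 1), hswap]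
  · rw [← hp.1.1 (Equiv.swap 0 1), hswap]
  · rw [hconst, hq.2, hp.2]

end LieGroup

end Pontryagin

end Shulman

/-! ### The main theorem -/

theorem mainTheorem2 {𝕜 : Type*} [RCLike 𝕜]
    {E : Type*} [NormedAddCommGroup E] [NormedSpace ℝ E] [FiniteDimensional ℝ E]
    {G : Type*} [TopologicalSpace G] [ChartedSpace E G] [Group G] [LieGroup 𝓘(ℝ, E) ∞ G]
    (N : ℕ) (ρ : G →* GL (Fin N) 𝕜)
    (hρ : Shulman.IsMatrixLieGroup E ρ ∨ Shulman.IsSpinCovering E ρ) :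
    ∃ p : MultilinearMap ℝ (fun _ : Fin 2 => GroupLieAlgebra 𝓘(ℝ, E) G) 𝕜,
      -- `p` is the unique first Pontryagin polynomial, and its explicit form
      Shulman.IsPontryaginPolynomial E ρ p ∧
      (∀ q : MultilinearMap ℝ (fun _ : Fin 2 => GroupLieAlgebra 𝓘(ℝ, E) G) 𝕜,
        Shulman.IsPontryaginPolynomial E ρ q → q = p) ∧
      (∀ A B : GroupLieAlgebra 𝓘(ℝ, E) G,
        p ![A, B] = ((1 / (8 * Real.pi ^ 2) : ℝ) : 𝕜) *
          ((Shulman.toMatrix E ρ A).trace * (Shulman.toMatrix E ρ B).trace -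
            (Shulman.toMatrix E ρ A * Shulman.toMatrix E ρ B).trace)) ∧
      -- it is real-valued on groups of unitary matrices
      ((∀ g : G, (ρ g : Matrix (Fin N) (Fin N) 𝕜) ∈ Matrix.unitaryGroup (Fin N) 𝕜) →
        ∀ A B : GroupLieAlgebra 𝓘(ℝ, E) G, RCLike.im (p ![A, B]) = 0) ∧
      -- `χ₁`
      (∀ (g : Fin 2 → G) (u : Fin 3 → ∀ j, TangentSpace 𝓘(ℝ, E) (g j)),
        Shulman.shulmanForm E p 1 g u = ((1 / (24 * Real.pi ^ 2) : ℝ) : 𝕜) *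
          Shulman.polyWedge 1 3
            (fun A : Fin 3 → GroupLieAlgebra 𝓘(ℝ, E) G =>
              (Shulman.toMatrix E ρ (A 0) * Shulman.toMatrix E ρ (A 1) *
                Shulman.toMatrix E ρ (A 2)).trace)
            (fun _ w => Shulman.omegaBar E 1 g (w 0)) u) ∧
      -- `χ₂`
      (∀ (g : Fin 3 → G) (u : Fin 2 → ∀ j, TangentSpace 𝓘(ℝ, E) (g j)),
        Shulman.shulmanForm E p 2 g u = ((1 / (8 * Real.pi ^ 2) : ℝ) : 𝕜) *
          (Shulman.polyWedge 1 2
              (fun A : Fin 2 → GroupLieAlgebra 𝓘(ℝ, E) G =>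
                (Shulman.toMatrix E ρ (A 0) * Shulman.toMatrix E ρ (A 1)).trace)
              ![fun w => Shulman.omegaBar E 1 g (w 0), fun w => Shulman.omegaBar E 2 g (w 0)] u -
            Shulman.polyWedge 1 2
              (fun A : Fin 2 → GroupLieAlgebra 𝓘(ℝ, E) G =>
                (Shulman.toMatrix E ρ (A 0)).trace * (Shulman.toMatrix E ρ (A 1)).trace)
              ![fun w => Shulman.omegaBar E 1 g (w 0), fun w => Shulman.omegaBar E 2 g (w 0)] u)) ∧
      -- all other forms vanish
      ∀ n : ℕ, n ≠ 1 → n ≠ 2 →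
        ∀ (g : Fin (n + 1) → G) (u : Fin (2 * 2 - n) → ∀ j, TangentSpace 𝓘(ℝ, E) (g j)),
          Shulman.shulmanForm E p n g u = 0 := by
  have hs : Shulman.IsSmoothImmersion E ρ := hρ.elim And.left And.left
  have : CompleteSpace E := FiniteDimensional.complete ℝ E
  obtain ⟨P, hP⟩ := Shulman.exists_leftInverse_derivOne_matrixHom hs
  have hR := Shulman.contMDiff_matrixHom hs
  have htr : ∀ X Y, Shulman.matrixAlgebraTrace 𝕜 N (X * Y) =
      Shulman.matrixAlgebraTrace 𝕜 N (Y * X) := fun X Y => Matrix.trace_mul_comm (m := Fin N) X Y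
  have hD := Shulman.derivOne_matrixHom hs
  have hp : ∀ X Y : E, Shulman.pontryagin E ρ ![X, Y] = Shulman.traceForm₂
      (tr := Shulman.matrixAlgebraTrace 𝕜 N) ((1 / (8 * Real.pi ^ 2) : ℝ) : 𝕜)
      (Shulman.derivOne E (Shulman.matrixHom ρ) X) (Shulman.derivOne E (Shulman.matrixHom ρ) Y) := by
    intro X Y
    rw [hD, hD]
    exact Shulman.pontryagin_apply ρ ![X, Y]
  have hω : ∀ {n : ℕ} (i : Fin (n + 1)) (g : Fin (n + 1) → G) (u : Fin (n + 1) → E),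
      Shulman.toMatrix E ρ (Shulman.omegaBar E i g u) =
        Shulman.linOmegaBar (Shulman.matrixHom ρ) i g u := fun i g u =>
    (hD _).symm.trans (Shulman.derivOne_omegaBar _ i g u)
  refine ⟨Shulman.pontryagin E ρ, Shulman.isPontryaginPolynomial_pontryagin hs,
    fun q hq => Shulman.eq_pontryagin_of_isPontryaginPolynomial hs hq,
    fun X Y => Shulman.pontryagin_apply ρ ![X, Y],
    fun hu X Y => Shulman.im_pontryagin_eq_zero hs hu ![X, Y], fun g u => ?_, fun g u => ?_,
    fun n h1 h2 g u => ?_⟩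
  · have hc : algebraMap ℝ 𝕜 (1 / 3) * ((1 / (8 * Real.pi ^ 2) : ℝ) : 𝕜) =
        ((1 / (24 * Real.pi ^ 2) : ℝ) : 𝕜) := by
      rw [RCLike.algebraMap_eq_ofReal, ← RCLike.ofReal_mul]
      congr 1
      ring
    refine (Shulman.shulmanForm_one _ hR hP htr hp g u).trans ?_
    rw [Algebra.smul_def, ← mul_assoc, hc]
    refine congrArg _ (Eq.trans ?_ (Shulman.polyWedge_one_three _ _ u).symm)
    exact Finset.sum_congr rfl fun σ _ => congrArg _ (congrArg (Matrix.trace (n := Fin N))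
      (congrArg₂ (· * ·) (congrArg₂ (· * ·) (hω 1 g (u (σ 0))) (hω 1 g (u (σ 1))))
        (hω 1 g (u (σ 2))))).symm
  · have h1 : ∀ x y : Fin 3 → E, (Shulman.toMatrix E ρ (Shulman.omegaBar E 1 g x) *
        Shulman.toMatrix E ρ (Shulman.omegaBar E 2 g y)).trace = Shulman.matrixAlgebraTrace 𝕜 N
        (Shulman.linOmegaBar (Shulman.matrixHom ρ) 1 g x *
          Shulman.linOmegaBar (Shulman.matrixHom ρ) 2 g y) := fun x y =>
      congrArg₂ (fun X Y : Matrix (Fin N) (Fin N) 𝕜 => (X * Y).trace) (hω 1 g x) (hω 2 g y)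
    have h2 : ∀ x y : Fin 3 → E, (Shulman.toMatrix E ρ (Shulman.omegaBar E 1 g x)).trace *
        (Shulman.toMatrix E ρ (Shulman.omegaBar E 2 g y)).trace = Shulman.matrixAlgebraTrace 𝕜 N
        (Shulman.linOmegaBar (Shulman.matrixHom ρ) 1 g x) * Shulman.matrixAlgebraTrace 𝕜 N
        (Shulman.linOmegaBar (Shulman.matrixHom ρ) 2 g y) := fun x y =>
      congrArg₂ (fun X Y : Matrix (Fin N) (Fin N) 𝕜 => X.trace * Y.trace) (hω 1 g x) (hω 2 g y)
    refine (Shulman.shulmanForm_two _ hR hP htr hp g u).trans ?_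
    refine Eq.trans ?_ (congrArg _ (congrArg₂ (· - ·)
      ((Shulman.polyWedge_one_two _ _ u).trans
        (congrArg₂ (· - ·) (h1 (u 0) (u 1)) (h1 (u 1) (u 0))))
      ((Shulman.polyWedge_one_two _ _ u).trans
        (congrArg₂ (· - ·) (h2 (u 0) (u 1)) (h2 (u 1) (u 0)))))).symm
    -- The trace form is a multiple of `tr X tr Y - tr (X Y)`; the minus sign in front of its wedge
    -- puts `tr (ω̄₁ ω̄₂)` first.
    simp only [Shulman.traceForm₂]
    ring
  · obtain rfl | hn : n = 0 ∨ 2 < n := by omega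
    · exact Shulman.shulmanForm_zero _ hR hP htr hp g u
    · exact Shulman.shulmanForm_of_two_lt _ hR hP htr hp hn g u
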